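/- Let $M$ be a smooth manifold (Hausdorff, second countable) and $E\to M$ a smooth real vector bundle of finite positive rank. Let $\mathfrak D E$ be the gauge Lie algebroid of $E$ (its sections are the operators $\mathfrak d$ on $\Gamma(E)$ with $\mathfrak d(fu)=x(f)u+f\mathfrak d(u)$ for a vector field $x=\alpha(\mathfrak d)$), let $\mathfrak J E$ be the first jet bundle of $E$, $\mathbb d:\Gamma(E)\to\Gamma(\mathfrak J E)$ the jet prolongation, $\mathbb p:\mathfrak JE\to E$ the projection, and $\langle\cdot,\cdot\rangle_E$ the $E$-valued pairing of $\mathfrak J E$ with $\mathfrak D E$ determined by $\langle\mathbb d u,\mathfrak d\rangle_E=\mathfrak d u$. Put $\mathcal E=\mathfrak D E\oplus\mathfrak J E$ with projection $\rho:\mathcal E\to\mathfrak DE$, with the form $(\mathfrak d+\mu,\mathfrak r+\nu)_E=\tfrac12(\langle\nu,\mathfrak d\rangle_E+\langle\mu,\mathfrak r\rangle_E)$ and the Dorfman bracket $$\{\mathfrak d+\mu,\mathfrak r+\nu\}=[\mathfrak d,\mathfrak r]+\mathfrak L_{\mathfrak d}\nu-\mathfrak L_{\mathfrak r}\mu+\mathbb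 d\langle\mu,\mathfrak r\rangle_E,\qquad \langle\mathfrak L_{\mathfrak d}\nu,\mathfrak r\rangle_E=\mathfrak d\langle\nu,\mathfrak r\rangle_E-\langle\nu,[\mathfrak d,\mathfrak r]\rangle_E .$$ Let $\mathbf b:\mathcal E\to\mathcal T=TM\oplus E$, $\mathbf b(\mathfrak d+\mu)=\alpha(\mathfrak d)+\mathbb p(\mu)$. A Dirac structure is a subbundle $L\subset\mathcal E$ with $L=L^\perp$ whose sections are closed under $\{\cdot,\cdot\}$; it is a Lie algebroid, represented on $E$ by $\rho_L=\rho|_L$, and $d_L$, $\mathrm H^\bullet(L,\rho_L)$ denote the coboundary operator and the cohomology of this representation. Put $N_L=\{X\in\Gamma(\mathcal E):\{X,\Gamma(L)\}\subset\Gamma(L)\}$ and, for $X\in\Gamma(\mathcal E)$, $\omega_X=(X,\cdot)_E|_L$. The falling of $X$ is the operator $\underline X$ on $\Gamma(\mathcal T)$ given by $\underline X(\mathbf bY)=\mathbf b\{X,Y\}$, with symbol $\alpha(\rho(X))$. Let $A\subset\mathcal T$ be a projective Lie algebroid, i.e. a subbundle with a Lie algebroid structure $[\cdot,\cdot]_A$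 whose anchor is the projection to $TM$. Let $\mathrm{Der}(A)$ be the space of sections $\delta$ of $\mathfrak D A$ that are derivations of $[\cdot,\cdot]_A$, $\mathrm{Inn}(A)$ the subspace of the $[a,\cdot]_A$, $a\in\Gamma(A)$, and $\mathrm{Ext}(A)=\mathrm{Der}(A)/\mathrm{Inn}(A)$. Let $L^A_m$ be the set of the $X_m$ with $X\in\Gamma(\mathbf b^{-1}(A))$ such that $\mathbf b\{X,Y\}_m=([\mathbf bX,\mathbf bY]_A)_m$ for all $Y\in\Gamma(\mathbf b^{-1}(A))$. Then $L=L^A$ is a Dirac structure, and: 1. for $X\in\Gamma(\mathcal E)$: $X\in N_L$ if and only if $d_L\omega_X=0$; 2. for $X\in N_L$: $\omega_X$ is a coboundary if and only if $\underline X|_A\in\mathrm{Inn}(A)$; 3. for every $\delta\in\mathrm{Der}(A)$ there is $X_\delta\in N_L$ with $\underline{X_\delta}|_A=\delta$, and $\delta\mapsto[\omega_{X_\delta}]$, which does not depend on the choice of $X_\delta$, induces an injective linear map $\mathrm{Ext}(A)\to\mathrm H^1(L^A,\rho_{L^A})$. -/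

import Mathlib

open scoped Manifold ContDiff Bundle

noncomputable section

/-! ## Smooth functions, vector fields and sections

`M` is a smooth manifold modelled on `ℝⁿ`, and `V → M` is a smooth real vector bundle with
model fibre `F` (the bundle called `E` in the usual notation). -/

namespace OmniLie

section Basics

variable (n : ℕ) {M : Type*} [TopologicalSpace M] [ChartedSpace (EuclideanSpace ℝ (Fin n)) M]

variable (M) in
/-- The ring `C^∞(M)`. -/
abbrev SmoothFn := C^∞⟮𝓡 n, M; 𝓘(ℝ), ℝ⟯

variable (M) in
/-- The smooth vector fields `𝔛(M)`. -/
abbrev VField [IsManifold (𝓡 n) ∞ M] :=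
  Cₛ^∞⟮𝓡 n; EuclideanSpace ℝ (Fin n), (TangentSpace (𝓡 n) : M → Type)⟯

variable (F : Type*) [NormedAddCommGroup F] [NormedSpace ℝ F]
  (V : M → Type*) [TopologicalSpace (Bundle.TotalSpace F V)] [∀ m, AddCommGroup (V m)]
  [∀ m, Module ℝ (V m)] [∀ m, TopologicalSpace (V m)] [FiberBundle F V] [VectorBundle ℝ F V]

/-- The smooth sections `Γ(E)` of the vector bundle. -/
abbrev Sec := Cₛ^∞⟮𝓡 n; F, V⟯

variable {n F V}

/-- Pointwise multiplication of a section by a smooth function. -/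
instance : SMul (SmoothFn n M) (Sec n F V) where
  smul f s := ⟨fun m => f m • s m, f.contMDiff.smul_section s.contMDiff⟩

@[simp] theorem smul_apply (f : SmoothFn n M) (s : Sec n F V) (m : M) :
    (f • s) m = f m • s m := rfl

/-- `Γ(E)` is a module over `C^∞(M)`. -/
instance : Module (SmoothFn n M) (Sec n F V) where
  one_smul s := by ext m; simp
  mul_smul f g s := by ext m; simp [mul_smul]
  smul_zero f := by ext m; simp
  smul_add f s t := by ext m; simp
  add_smul f g s := by ext m; simp [add_smul]
  zero_smul s := by ext m; simp

instance : SMulCommClass ℝ (SmoothFn n M) (Sec n F V) where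
  smul_comm c f s := by ext m; exact smul_comm c (f m) (s m)

instance : SMulCommClass (SmoothFn n M) ℝ (Sec n F V) where
  smul_comm f c s := by ext m; exact smul_comm (f m) c (s m)

instance : IsScalarTower ℝ (SmoothFn n M) (Sec n F V) where
  smul_assoc c f s := by ext m; exact smul_assoc c (f m) (s m)

theorem mdiffAt_fn (f : SmoothFn n M) (m : M) :
    MDifferentiableAt (𝓡 n) 𝓘(ℝ) f m :=
  f.contMDiff.mdifferentiable (by simp) m

end Basics

section VectorFields

variable {n : ℕ} {M : Type*} [TopologicalSpace M] [ChartedSpace (EuclideanSpace ℝ (Fin n)) M]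
  [IsManifold (𝓡 n) ∞ M]

theorem contMDiff_deriv (x : VField n M) (f : SmoothFn n M) :
    ContMDiff (𝓡 n) 𝓘(ℝ) ∞ fun m => mvfderiv (𝓡 n) f m (x m) := by
  have h : ContMDiff (𝓡 n).tangent 𝓘(ℝ).tangent ∞ (tangentMap (𝓡 n) 𝓘(ℝ) f) :=
    f.contMDiff.contMDiff_tangentMap (by simp)
  exact (contMDiff_snd_tangentBundle_modelSpace ℝ 𝓘(ℝ)).comp (h.comp x.contMDiff)

/-- The derivative `x(f)` of a smooth function `f` along a vector field `x`. -/
def VField.app (x : VField n M) (f : SmoothFn n M) : SmoothFn n M :=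
  ⟨fun m => mvfderiv (𝓡 n) f m (x m), contMDiff_deriv x f⟩

/-- The Lie bracket `[x, y]` of two smooth vector fields. -/
def VField.lie (x y : VField n M) : VField n M :=
  ⟨fun m => VectorField.mlieBracket (𝓡 n) x y m, by
    have : IsManifold (𝓡 n) ((⊤ : ℕ∞) + 1) M := inferInstanceAs (IsManifold (𝓡 n) ∞ M)
    have : IsManifold (𝓡 n) (minSmoothness ℝ 2) M := by
      rw [minSmoothness_of_isRCLikeNormedField]; infer_instance
    have : IsManifold (𝓡 n) (minSmoothness ℝ 3) M := by
      rw [minSmoothness_of_isRCLikeNormedField]; infer_instance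
    exact ContDiff.mlieBracket_vectorField (m := ⊤) (n := ⊤) x.contMDiff y.contMDiff (by simp)⟩

theorem VField.app_apply (x : VField n M) (f : SmoothFn n M) (m : M) :
    x.app f m = mvfderiv (𝓡 n) f m (x m) := rfl

theorem VField.app_add_fn (x : VField n M) (f g : SmoothFn n M) :
    x.app (f + g) = x.app f + x.app g := by
  ext m
  simp [app_apply, mvfderiv_add (mdiffAt_fn f m) (mdiffAt_fn g m)]

theorem VField.app_mul (x : VField n M) (f g : SmoothFn n M) :
    x.app (f * g) = f * x.app g + g * x.app f := by
  ext m
  simp [app_apply, mvfderiv_mul (mdiffAt_fn f m) (mdiffAt_fn g m)]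

@[simp] theorem VField.add_app (x y : VField n M) (f : SmoothFn n M) :
    (x + y).app f = x.app f + y.app f := by
  ext m; simp [app_apply]

@[simp] theorem VField.zero_app (f : SmoothFn n M) : (0 : VField n M).app f = 0 := by
  ext m; simp [app_apply]

@[simp] theorem VField.smul_app (g : SmoothFn n M) (x : VField n M) (f : SmoothFn n M) :
    (g • x).app f = g * x.app f := by
  ext m; simp [app_apply]

theorem VField.lie_smul (x y : VField n M) (f : SmoothFn n M) :
    x.lie (f • y) = x.app f • y + f • x.lie y := by
  ext1 m
  exact VectorField.mlieBracket_smul_right (V := x) (W := y) (mdiffAt_fn f m) y.mdifferentiableAt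

theorem VField.lie_add (x y z : VField n M) : x.lie (y + z) = x.lie y + x.lie z := by
  ext1 m
  exact VectorField.mlieBracket_add_right y.mdifferentiableAt z.mdifferentiableAt

@[simp] theorem VField.lie_zero (x : VField n M) : x.lie 0 = 0 := by
  simpa using VField.lie_add x 0 0

theorem VField.lie_swap (x y : VField n M) : x.lie y = - y.lie x := by
  ext1 m
  exact VectorField.mlieBracket_swap_apply

theorem VField.add_lie (x y z : VField n M) : (x + y).lie z = x.lie z + y.lie z := by
  ext1 m
  exact VectorField.mlieBracket_add_left x.mdifferentiableAt y.mdifferentiableAt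

theorem VField.rsmul_lie (c : ℝ) (x y : VField n M) : (c • x).lie y = c • x.lie y := by
  ext1 m
  exact VectorField.mlieBracket_const_smul_left x.mdifferentiableAt

@[simp] theorem VField.zero_lie (x : VField n M) : (0 : VField n M).lie x = 0 := by
  simpa using VField.add_lie 0 0 x

theorem VField.lie_jacobi (x y z : VField n M) :
    x.lie (y.lie z) = (x.lie y).lie z + y.lie (x.lie z) := by
  ext1 m
  have : IsManifold (𝓡 n) (minSmoothness ℝ 3) M := by
    rw [minSmoothness_of_isRCLikeNormedField]; infer_instance
  have h2 : minSmoothness ℝ 2 ≤ (∞ : ℕ∞ω) := by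
    rw [minSmoothness_of_isRCLikeNormedField]
    exact WithTop.coe_le_coe.2 (le_top : (2 : ℕ∞) ≤ ⊤)
  have h : ∀ w : VField n M, ContMDiffAt (𝓡 n) (𝓡 n).tangent (minSmoothness ℝ 2)
      (fun p => (⟨p, w p⟩ : TangentBundle (𝓡 n) M)) m := fun w =>
    (w.contMDiff m).of_le h2
  exact VectorField.leibniz_identity_mlieBracket_apply (h x) (h y) (h z)

/-- `[x, y](f) = x(y(f)) - y(x(f))`. -/
theorem VField.lie_app (x y : VField n M) (f : SmoothFn n M) :
    (x.lie y).app f = x.app (y.app f) - y.app (x.app f) := by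
  have key : ∀ z : VField n M,
      (x.lie y).app f • z = (x.app (y.app f) - y.app (x.app f)) • z := by
    intro z
    have h := lie_jacobi x y (f • z)
    simp only [lie_smul, lie_add] at h
    rw [lie_jacobi x y z, ← sub_eq_zero] at h
    rw [← sub_eq_zero, ← neg_eq_zero, ← h]
    module
  ext m
  have key' : ∀ z : VField n M, z m ≠ 0 →
      (x.lie y).app f m = (x.app (y.app f) - y.app (x.app f)) m := fun z hz =>
    smul_left_injective ℝ hz (congrArg (fun s : VField n M => s m) (key z))
  by_cases hx : x m = 0
  · by_cases hy : y m = 0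
    · have hl : x.lie y m = 0 := by
        have h := VectorField.mlieBracketWithin_eq_zero_of_eq_zero (I := 𝓡 n) (V := x) (W := y)
          (s := Set.univ) hx hy
        rwa [VectorField.mlieBracketWithin_univ] at h
      simp [app_apply, hx, hy, hl]
    · exact key' y hy
  · exact key' x hx

end VectorFields

/-! ## The omni-Lie algebroid `𝓔 = 𝔇E ⊕ 𝔍E` -/

section Omni

variable (n : ℕ) {M : Type*} [TopologicalSpace M] [ChartedSpace (EuclideanSpace ℝ (Fin n)) M]
  [IsManifold (𝓡 n) ∞ M]
  (F : Type*) [NormedAddCommGroup F] [NormedSpace ℝ F]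
  (V : M → Type*) [TopologicalSpace (Bundle.TotalSpace F V)] [∀ m, AddCommGroup (V m)]
  [∀ m, Module ℝ (V m)] [∀ m, TopologicalSpace (V m)] [FiberBundle F V] [VectorBundle ℝ F V]

/-- `Γ(𝔇E)`: sections of the gauge Lie algebroid, i.e. covariant differential operators
`𝔡 : Γ(E) → Γ(E)` with symbol a vector field `x`: `𝔡(f u) = x(f) u + f 𝔡(u)`.
An element is the pair `(𝔡, x)`. -/
def gaugeSubmodule : Submodule (SmoothFn n M) ((Sec n F V →ₗ[ℝ] Sec n F V) × VField n M) where
  carrier := {d | ∀ (f : SmoothFn n M) (u : Sec n F V), d.1 (f • u) = d.2.app f • u + f • d.1 u}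
  add_mem' {d r} hd hr f u := by
    simp only [Set.mem_ofPred_eq] at hd hr
    simp only [Prod.fst_add, Prod.snd_add, LinearMap.add_apply, hd, hr, VField.add_app]
    module
  zero_mem' f u := by simp
  smul_mem' g d hd f u := by
    simp only [Set.mem_ofPred_eq] at hd
    simp only [Prod.smul_fst, Prod.smul_snd, LinearMap.smul_apply, hd, VField.smul_app]
    module

/-- `Γ(𝔇E)`. -/
def GaugeSec := ↥(gaugeSubmodule n F V)

variable {n F V}

instance : AddCommGroup (GaugeSec n F V) := inferInstanceAs (AddCommGroup ↥(gaugeSubmodule n F V))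
instance : Module (SmoothFn n M) (GaugeSec n F V) := inferInstanceAs (Module _ ↥(gaugeSubmodule n F V))
instance : Module ℝ (GaugeSec n F V) := inferInstanceAs (Module ℝ ↥(gaugeSubmodule n F V))
instance : IsScalarTower ℝ (SmoothFn n M) (GaugeSec n F V) :=
  inferInstanceAs (IsScalarTower ℝ _ ↥(gaugeSubmodule n F V))

namespace GaugeSec

/-- The differential operator underlying a section of `𝔇E`. -/
def op (d : GaugeSec n F V) : Sec n F V →ₗ[ℝ] Sec n F V := d.1.1

/-- The anchor `α : 𝔇E → TM` on sections. -/
def symbol (d : GaugeSec n F V) : VField n M := d.1.2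

theorem op_smul (d : GaugeSec n F V) (f : SmoothFn n M) (u : Sec n F V) :
    d.op (f • u) = d.symbol.app f • u + f • d.op u := d.2 f u

@[ext] theorem ext {d r : GaugeSec n F V} (h : ∀ u, d.op u = r.op u) (h' : d.symbol = r.symbol) :
    d = r :=
  Subtype.ext (Prod.ext (LinearMap.ext h) h')

@[simp] theorem op_add (d r : GaugeSec n F V) (u) : (d + r).op u = d.op u + r.op u := rfl
@[simp] theorem op_fsmul (f : SmoothFn n M) (d : GaugeSec n F V) (u) :
    (f • d).op u = f • d.op u := rfl
@[simp] theorem op_rsmul (c : ℝ) (d : GaugeSec n F V) (u) : (c • d).op u = c • d.op u := rfl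
@[simp] theorem symbol_add (d r : GaugeSec n F V) : (d + r).symbol = d.symbol + r.symbol := rfl
@[simp] theorem op_sub (d r : GaugeSec n F V) (u) : (d - r).op u = d.op u - r.op u := rfl
@[simp] theorem symbol_sub (d r : GaugeSec n F V) : (d - r).symbol = d.symbol - r.symbol := rfl
@[simp] theorem symbol_fsmul (f : SmoothFn n M) (d : GaugeSec n F V) :
    (f • d).symbol = f • d.symbol := rfl
@[simp] theorem symbol_rsmul (c : ℝ) (d : GaugeSec n F V) :
    (c • d).symbol = c • d.symbol := rfl

variable (n F V) in
/-- The identity `𝟏_E`, as a section of `gl(E) ⊂ 𝔇E`. -/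
def one : GaugeSec n F V := ⟨(LinearMap.id, 0), fun f u => by simp⟩

@[simp] theorem one_op (u) : (one n F V).op u = u := rfl
@[simp] theorem one_symbol : (one n F V).symbol = 0 := rfl

/-- The commutator bracket of `𝔇E`. -/
def lie (d r : GaugeSec n F V) : GaugeSec n F V :=
  ⟨(d.op ∘ₗ r.op - r.op ∘ₗ d.op, d.symbol.lie r.symbol), fun f u => by
    simp only [LinearMap.sub_apply, LinearMap.comp_apply, op_smul, map_add, VField.lie_app]
    module⟩

@[simp] theorem lie_op (d r : GaugeSec n F V) (u) :
    (d.lie r).op u = d.op (r.op u) - r.op (d.op u) := rfl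
@[simp] theorem lie_symbol (d r : GaugeSec n F V) :
    (d.lie r).symbol = d.symbol.lie r.symbol := rfl

theorem lie_add (d r s : GaugeSec n F V) : d.lie (r + s) = d.lie r + d.lie s := by
  ext1 <;> simp [VField.lie_add]; abel

theorem lie_smul (d r : GaugeSec n F V) (f : SmoothFn n M) :
    d.lie (f • r) = d.symbol.app f • r + f • d.lie r := by
  ext1
  · simp only [lie_op, op_fsmul, op_smul, op_add]; module
  · simp [VField.lie_smul]

end GaugeSec

variable (n F V) in
/-- `Γ(𝔍E)`: sections of the first jet bundle, through its `E`-duality with `𝔇E`: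
`𝔍E = {ν ∈ Hom(𝔇E, E) | ν(Φ) = Φ(ν(𝟏_E)) for all Φ ∈ gl(E)}`, where `gl(E) = ker α`.
The `E`-pairing `⟨μ, 𝔡⟩_E` is `μ 𝔡`. -/
def jetSubmodule : Submodule (SmoothFn n M) (GaugeSec n F V →ₗ[SmoothFn n M] Sec n F V) where
  carrier := {μ | ∀ Φ : GaugeSec n F V, Φ.symbol = 0 → μ Φ = Φ.op (μ (.one n F V))}
  add_mem' {μ ν} hμ hν Φ h := by
    simp only [Set.mem_ofPred_eq] at hμ hν
    simp [hμ Φ h, hν Φ h]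
  zero_mem' Φ h := by simp
  smul_mem' f μ hμ Φ h := by
    simp only [Set.mem_ofPred_eq] at hμ
    simp [hμ Φ h, GaugeSec.op_smul, h]

variable (n F V) in
/-- `Γ(𝔍E)`. -/
def JetSec := ↥(jetSubmodule n F V)

instance : AddCommGroup (JetSec n F V) := inferInstanceAs (AddCommGroup ↥(jetSubmodule n F V))
instance : Module (SmoothFn n M) (JetSec n F V) := inferInstanceAs (Module _ ↥(jetSubmodule n F V))
instance : Module ℝ (JetSec n F V) := inferInstanceAs (Module ℝ ↥(jetSubmodule n F V))
instance : IsScalarTower ℝ (SmoothFn n M) (JetSec n F V) :=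
  inferInstanceAs (IsScalarTower ℝ _ ↥(jetSubmodule n F V))

namespace JetSec

/-- The `E`-valued pairing `⟨μ, 𝔡⟩_E`. -/
def pair (μ : JetSec n F V) (d : GaugeSec n F V) : Sec n F V := μ.1 d

/-- The projection `𝕡 : 𝔍E → E` on sections. -/
def proj (μ : JetSec n F V) : Sec n F V := μ.pair (.one n F V)

@[ext] theorem ext {μ ν : JetSec n F V} (h : ∀ d, μ.pair d = ν.pair d) : μ = ν :=
  Subtype.ext (LinearMap.ext h)

@[simp] theorem pair_add (μ : JetSec n F V) (d r) : μ.pair (d + r) = μ.pair d + μ.pair r :=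
  map_add μ.1 d r
@[simp] theorem pair_sub (μ : JetSec n F V) (d r) : μ.pair (d - r) = μ.pair d - μ.pair r :=
  map_sub μ.1 d r
@[simp] theorem pair_fsmul (μ : JetSec n F V) (f : SmoothFn n M) (d) :
    μ.pair (f • d) = f • μ.pair d := map_smul μ.1 f d
@[simp] theorem add_pair (μ ν : JetSec n F V) (d) : (μ + ν).pair d = μ.pair d + ν.pair d := rfl
@[simp] theorem fsmul_pair (f : SmoothFn n M) (μ : JetSec n F V) (d) :
    (f • μ).pair d = f • μ.pair d := rfl
@[simp] theorem rsmul_pair (c : ℝ) (μ : JetSec n F V) (d) :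
    (c • μ).pair d = c • μ.pair d := rfl
@[simp] theorem sub_pair (μ ν : JetSec n F V) (d) : (μ - ν).pair d = μ.pair d - ν.pair d := rfl

theorem pair_gl (μ : JetSec n F V) {Φ : GaugeSec n F V} (h : Φ.symbol = 0) :
    μ.pair Φ = Φ.op μ.proj := μ.2 Φ h

/-- The first jet prolongation `𝕕 u` of a section `u`: `⟨𝕕 u, 𝔡⟩_E = 𝔡 u`. -/
def jet (u : Sec n F V) : JetSec n F V :=
  ⟨{ toFun := fun d => d.op u
     map_add' := fun _ _ => rfl
     map_smul' := fun _ _ => rfl }, fun _ _ => rfl⟩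

@[simp] theorem jet_pair (u : Sec n F V) (d) : (jet u).pair d = d.op u := rfl

/-- The Lie derivative `𝔏_𝔡 μ`: `⟨𝔏_𝔡 μ, 𝔯⟩_E = 𝔡⟨μ, 𝔯⟩_E - ⟨μ, [𝔡, 𝔯]⟩_E`. -/
def lieDeriv (d : GaugeSec n F V) (μ : JetSec n F V) : JetSec n F V :=
  ⟨{ toFun := fun r => d.op (μ.pair r) - μ.pair (d.lie r)
     map_add' := fun r s => by simp [GaugeSec.lie_add]; abel
     map_smul' := fun f r => by
      simp only [pair_fsmul, GaugeSec.op_smul, GaugeSec.lie_smul, pair_add, RingHom.id_apply]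
      module },
   fun Φ h => by
    have h1 : (d.lie (.one n F V)).symbol = 0 := by simp
    have h2 : (d.lie Φ).symbol = 0 := by simp [h]
    simp [pair_gl μ h, pair_gl μ h1, pair_gl μ h2]
    rfl⟩

@[simp] theorem lieDeriv_pair (d : GaugeSec n F V) (μ : JetSec n F V) (r) :
    (lieDeriv d μ).pair r = d.op (μ.pair r) - μ.pair (d.lie r) := rfl

end JetSec

variable (n F V) in
/-- `Γ(𝓔)` for `𝓔 = 𝔇E ⊕ 𝔍E`. An element `(𝔡, μ)` stands for `𝔡 + μ`; the first component is
the projection `ρ`. -/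
abbrev OmniSec := GaugeSec n F V × JetSec n F V

variable (n F V) in
/-- `Γ(𝓣)` for `𝓣 = TM ⊕ E`. -/
abbrev TSec := VField n M × Sec n F V

namespace OmniSec

/-- The Dorfman bracket
`{𝔡 + μ, 𝔯 + ν} = [𝔡, 𝔯] + 𝔏_𝔡 ν - 𝔏_𝔯 μ + 𝕕⟨μ, 𝔯⟩_E`. -/
def dorfman (X Y : OmniSec n F V) : OmniSec n F V :=
  (X.1.lie Y.1, .lieDeriv X.1 Y.2 - .lieDeriv Y.1 X.2 + .jet (X.2.pair Y.1))

/-- The symmetric `E`-valued form `(𝔡 + μ, 𝔯 + ν)_E = ½ (⟨𝔡, ν⟩_E + ⟨𝔯, μ⟩_E)`. -/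
def pairing (X Y : OmniSec n F V) : Sec n F V := (1 / 2 : ℝ) • (Y.2.pair X.1 + X.2.pair Y.1)

variable (n F V) in
/-- The projection `𝐛 : 𝓔 → 𝓣`, `𝐛(𝔡 + μ) = α(𝔡) + 𝕡(μ)`, on sections. -/
def b : OmniSec n F V →ₗ[SmoothFn n M] TSec n F V where
  toFun X := (X.1.symbol, X.2.proj)
  map_add' _ _ := rfl
  map_smul' _ _ := rfl

end OmniSec

namespace OmniSec

theorem b_dorfman (X Y : OmniSec n F V) :
    b n F V (dorfman X Y) = (X.1.symbol.lie Y.1.symbol,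
      X.1.op Y.2.proj - Y.1.op X.2.proj + X.2.pair Y.1) := by
  have h : ∀ (d : GaugeSec n F V) (μ : JetSec n F V), μ.pair (d.lie (.one n F V)) = 0 := by
    intro d μ
    have h1 : (d.lie (.one n F V)).symbol = 0 := by simp
    simp [JetSec.pair_gl μ h1]
  refine Prod.ext rfl ?_
  change (JetSec.lieDeriv X.1 Y.2 - JetSec.lieDeriv Y.1 X.2 + JetSec.jet (X.2.pair Y.1)).proj = _
  simp [JetSec.proj, h]

theorem b_dorfman_add (X X' Y : OmniSec n F V) : b n F V (dorfman (X + X') Y) =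
    b n F V (dorfman X Y) + b n F V (dorfman X' Y) := by
  simp only [b_dorfman]
  refine Prod.ext (VField.add_lie _ _ _) ?_
  change (X.1 + X'.1).op Y.2.proj - Y.1.op (X.2.proj + X'.2.proj) + (X.2 + X'.2).pair Y.1 = _
  simp
  abel

theorem b_dorfman_smul (c : ℝ) (X Y : OmniSec n F V) :
    b n F V (dorfman (c • X) Y) = c • b n F V (dorfman X Y) := by
  simp only [b_dorfman]
  refine Prod.ext (VField.rsmul_lie _ _ _) ?_
  change (c • X.1).op Y.2.proj - Y.1.op (c • X.2.proj) + (c • X.2).pair Y.1 = _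
  simp [smul_sub]

open Classical in
/-- The falling operator `X ↦ X̲ : Γ(𝓣) → Γ(𝓣)`, `X̲(t) = 𝐛{X, Y}` for any `Y ∈ Γ(𝓔)` with
`𝐛 Y = t`. As a section of `𝔇𝓣`, its symbol is the vector field `α(ρ(X))`. -/
def falling (X : OmniSec n F V) (t : TSec n F V) : TSec n F V :=
  if h : ∃ Y, b n F V Y = t then b n F V (dorfman X h.choose) else 0

/-- The value of the falling operator does not depend on the chosen lift. -/
theorem falling_b (X Y : OmniSec n F V) : falling X (b n F V Y) = b n F V (dorfman X Y) := by
  have h : ∃ Y', b n F V Y' = b n F V Y := ⟨Y, rfl⟩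
  rw [falling, dif_pos h]
  have h1 := h.choose_spec
  generalize h.choose = Y' at h1
  have hs : Y'.1.symbol = Y.1.symbol := congrArg Prod.fst h1
  have hp : Y'.2.proj = Y.2.proj := congrArg Prod.snd h1
  have h2 : (Y'.1 - Y.1).symbol = 0 := by simp [hs]
  have h3 := JetSec.pair_gl X.2 h2
  rw [JetSec.pair_sub, GaugeSec.op_sub, sub_eq_sub_iff_add_eq_add] at h3
  rw [b_dorfman, b_dorfman, hs, hp]
  refine Prod.ext rfl ?_
  simp only [sub_add_eq_add_sub, sub_eq_sub_iff_add_eq_add, add_assoc, h3]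
  rw [add_comm (X.2.pair Y.1)]

end OmniSec

/-! ## Fibres and subbundles -/

variable (n V) in
/-- The fibre `𝓣_m = T_m M ⊕ E_m`. -/
abbrev TFiber (m : M) := TangentSpace (𝓡 n) m × V m

/-- Evaluation of a section of `𝓣` at `m`. -/
def evT (m : M) : TSec n F V →ₗ[ℝ] TFiber n V m where
  toFun t := (t.1 m, t.2 m)
  map_add' _ _ := rfl
  map_smul' _ _ := rfl

variable (n F V) in
/-- The sections of `𝓔` that vanish at `m`. -/
def vanishAt (m : M) : Submodule ℝ (OmniSec n F V) where
  carrier := {X | X.1.symbol m = 0 ∧ (∀ u, X.1.op u m = 0) ∧ ∀ d, X.2.pair d m = 0}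
  add_mem' {X Y} hX hY := by
    obtain ⟨h1, h2, h3⟩ := hX
    obtain ⟨k1, k2, k3⟩ := hY
    exact ⟨by simp [h1, k1], fun u => by simp [h2, k2], fun d => by simp [h3, k3]⟩
  zero_mem' := ⟨rfl, fun _ => rfl, fun _ => rfl⟩
  smul_mem' c X hX := by
    obtain ⟨h1, h2, h3⟩ := hX
    exact ⟨by simp [h1], fun u => by simp [h2], fun d => by simp [h3]⟩

variable (n F V) in
/-- The fibre `𝓔_m`: sections modulo those that vanish at `m`. -/
abbrev OmniFiber (m : M) := OmniSec n F V ⧸ vanishAt n F V m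

/-- Evaluation `X ↦ X_m` of a section of `𝓔` at `m`. -/
def ev (m : M) : OmniSec n F V →ₗ[ℝ] OmniFiber n F V m := (vanishAt n F V m).mkQ

theorem ev_smul (m : M) (f : SmoothFn n M) (X : OmniSec n F V) : ev m (f • X) = f m • ev m X := by
  rw [← map_smul, ← sub_eq_zero, ← map_sub]
  refine (Submodule.Quotient.mk_eq_zero _).2 ⟨?_, fun u => ?_, fun d => ?_⟩
  · change f m • X.1.symbol m - f m • X.1.symbol m = 0
    simp
  · change f m • X.1.op u m - f m • X.1.op u m = 0
    simp
  · change f m • X.2.pair d m - f m • X.2.pair d m = 0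
    simp

/-- A family of subspaces `L_m` of the fibres `P_m` of a vector bundle with space of smooth sections
`Γ` is a (smooth) subbundle: near every point it has a smooth frame. (A frame on a neighbourhood can
be cut off to smooth sections over all of `M`, at the price of shrinking the neighbourhood.) -/
def IsSubbundle {Γ : Type*} [AddCommMonoid Γ] [Module ℝ Γ] {P : M → Type*}
    [∀ m, AddCommMonoid (P m)] [∀ m, Module ℝ (P m)] (e : ∀ m, Γ →ₗ[ℝ] P m)
    (L : ∀ m, Submodule ℝ (P m)) : Prop :=
  ∀ m₀ : M, ∃ (k : ℕ) (s : Fin k → Γ), ∀ᶠ m in nhds m₀,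
    LinearIndependent ℝ (fun i => e m (s i)) ∧
      Submodule.span ℝ (Set.range fun i => e m (s i)) = L m

/-- `Γ(A)` for a subbundle `A ⊂ 𝓣`. -/
def tSections (A : ∀ m : M, Submodule ℝ (TFiber n V m)) :
    Submodule (SmoothFn n M) (TSec n F V) where
  carrier := {t | ∀ m, evT m t ∈ A m}
  add_mem' {s t} hs ht m := by rw [map_add]; exact add_mem (hs m) (ht m)
  zero_mem' m := by rw [map_zero]; exact zero_mem _
  smul_mem' f t ht m := (A m).smul_mem (f m) (ht m)

/-- `Γ(A)`, as a type. -/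
def TSections (A : ∀ m : M, Submodule ℝ (TFiber n V m)) := ↥(tSections (F := F) A)

section

variable (A : ∀ m : M, Submodule ℝ (TFiber n V m))

instance : AddCommGroup (TSections (F := F) A) := inferInstanceAs (AddCommGroup ↥(tSections (F := F) A))
instance : Module (SmoothFn n M) (TSections (F := F) A) := inferInstanceAs (Module _ ↥(tSections (F := F) A))
instance : Module ℝ (TSections (F := F) A) := inferInstanceAs (Module ℝ ↥(tSections (F := F) A))
instance : IsScalarTower ℝ (SmoothFn n M) (TSections (F := F) A) :=
  inferInstanceAs (IsScalarTower ℝ _ ↥(tSections (F := F) A))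

end

/-- `Γ(L)` for a subbundle `L ⊂ 𝓔`. -/
def omniSections (L : ∀ m : M, Submodule ℝ (OmniFiber n F V m)) :
    Submodule (SmoothFn n M) (OmniSec n F V) where
  carrier := {X | ∀ m, ev m X ∈ L m}
  add_mem' {s t} hs ht m := by rw [map_add]; exact add_mem (hs m) (ht m)
  zero_mem' m := by rw [map_zero]; exact zero_mem _
  smul_mem' f t ht m := by rw [ev_smul]; exact (L m).smul_mem (f m) (ht m)

/-- `Γ(L)`, as a type. -/
def OmniSections (L : ∀ m : M, Submodule ℝ (OmniFiber n F V m)) := ↥(omniSections L)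

section

variable (L : ∀ m : M, Submodule ℝ (OmniFiber n F V m))

instance : AddCommGroup (OmniSections L) := inferInstanceAs (AddCommGroup ↥(omniSections L))
instance : Module (SmoothFn n M) (OmniSections L) := inferInstanceAs (Module _ ↥(omniSections L))
instance : Module ℝ (OmniSections L) := inferInstanceAs (Module ℝ ↥(omniSections L))
instance : IsScalarTower ℝ (SmoothFn n M) (OmniSections L) :=
  inferInstanceAs (IsScalarTower ℝ _ ↥(omniSections L))

end

/-! ## Projective Lie algebroids and their derivations -/

variable (n F V) in
/-- A projective Lie algebroid: a subbundle `A ⊂ 𝓣 = TM ⊕ E` with a Lie algebroid structure whose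
anchor is the projection to `TM`. -/
structure ProjLieAlgebroid where
  /-- the fibres `A_m ⊂ T_m M ⊕ E_m` -/
  fiber : ∀ m : M, Submodule ℝ (TFiber n V m)
  isSubbundle : IsSubbundle (Γ := TSec n F V) evT fiber
  /-- the Lie bracket `[·, ·]_A` on `Γ(A)` -/
  bracket : TSections (F := F) fiber →ₗ[ℝ] TSections (F := F) fiber →ₗ[ℝ] TSections (F := F) fiber
  bracket_self : ∀ a, bracket a a = 0
  jacobi : ∀ a b c, bracket a (bracket b c) = bracket (bracket a b) c + bracket b (bracket a c)
  anchor_bracket : ∀ a b, (bracket a b).1.1 = a.1.1.lie b.1.1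
  leibniz : ∀ (a b) (f : SmoothFn n M), bracket a (f • b) = a.1.1.app f • b + f • bracket a b

namespace ProjLieAlgebroid

variable (A : ProjLieAlgebroid n F V)

/-- `Γ(A)`. -/
abbrev Sections := TSections (F := F) A.fiber

/-- `Der(A)`: the derivations of `A`, i.e. sections `δ` of `𝔇A` (operators on `Γ(A)` with symbol a
vector field `x`, where `δ(f a) = x(f) a + f δ(a)`) that are derivations of the bracket. An element
is the pair `(δ, x)`; where `A` has positive rank, `x` is determined by the operator. -/
def derSubmodule : Submodule ℝ ((A.Sections →ₗ[ℝ] A.Sections) × VField n M) where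
  carrier := {δ | (∀ (f : SmoothFn n M) a, δ.1 (f • a) = δ.2.app f • a + f • δ.1 a) ∧
    ∀ a b, δ.1 (A.bracket a b) = A.bracket (δ.1 a) b + A.bracket a (δ.1 b)}
  add_mem' {d r} hd hr := by
    refine ⟨fun f a => ?_, fun a b => ?_⟩
    · simp only [Prod.fst_add, Prod.snd_add, LinearMap.add_apply, hd.1, hr.1, VField.add_app]
      module
    · simp only [Prod.fst_add, LinearMap.add_apply, hd.2, hr.2, map_add]
      abel
  zero_mem' := ⟨fun f a => by simp, fun a b => by simp⟩
  smul_mem' c d hd := by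
    refine ⟨fun f a => ?_, fun a b => ?_⟩
    · have h : (c • d.2).app f = c • d.2.app f := by ext m; simp [VField.app_apply]
      simp only [Prod.smul_fst, Prod.smul_snd, LinearMap.smul_apply, hd.1, h, smul_add, smul_assoc,
        smul_comm c f]
    · simp [hd.2]

/-- `Der(A)`. -/
def Der := ↥A.derSubmodule

instance : AddCommGroup A.Der := inferInstanceAs (AddCommGroup ↥A.derSubmodule)
instance : Module ℝ A.Der := inferInstanceAs (Module ℝ ↥A.derSubmodule)

/-- `a ↦ [a, ·]_A`, a derivation with symbol the anchor of `a`. -/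
def ad : A.Sections →ₗ[ℝ] A.Der where
  toFun a := ⟨(A.bracket a, a.1.1), fun f b => A.leibniz a b f, fun b c => A.jacobi a b c⟩
  map_add' a b := Subtype.ext (Prod.ext (map_add A.bracket a b) rfl)
  map_smul' c a := Subtype.ext (Prod.ext (map_smul A.bracket c a) rfl)

/-- `Inn(A)`: the inner derivations `[a, ·]_A`. -/
def inn : Submodule ℝ A.Der := LinearMap.range A.ad

/-- `Ext(A) = Der(A) / Inn(A)`. -/
abbrev Ext := A.Der ⧸ A.inn

/-- The restriction to `A` of the falling of `X` is the derivation `δ` (as sections of `𝔇A`, i.e.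
with the same symbol). -/
def FallsTo (X : OmniSec n F V) (δ : A.Der) : Prop :=
  (∀ a : A.Sections, OmniSec.falling X a.1 = (δ.1.1 a).1) ∧ X.1.symbol = δ.1.2

/-- The fibre at `m` of the lift `L^A ⊂ 𝐛⁻¹(A)`: the vectors `X_m` for `X ∈ Γ(𝐛⁻¹(A))` with
`𝐛{X, Y}_m = ([𝐛 X, 𝐛 Y]_A)_m` for all `Y ∈ Γ(𝐛⁻¹(A))`. -/
def liftFiber (m : M) : Submodule ℝ (OmniFiber n F V m) where
  carrier := {ξ | ∃ (X : OmniSec n F V) (hX : OmniSec.b n F V X ∈ tSections A.fiber), ev m X = ξ ∧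
    ∀ (Y : OmniSec n F V) (hY : OmniSec.b n F V Y ∈ tSections A.fiber),
      evT m (OmniSec.b n F V (.dorfman X Y)) =
        evT m (A.bracket ⟨OmniSec.b n F V X, hX⟩ ⟨OmniSec.b n F V Y, hY⟩).1}
  add_mem' := by
    rintro _ _ ⟨X, hX, rfl, h⟩ ⟨X', hX', rfl, h'⟩
    refine ⟨X + X', by rw [map_add]; exact add_mem hX hX', map_add _ _ _, fun Y hY => ?_⟩
    have e1 : OmniSec.b n F V (.dorfman (X + X') Y) =
        OmniSec.b n F V (.dorfman X Y) + OmniSec.b n F V (.dorfman X' Y) :=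
      OmniSec.b_dorfman_add X X' Y
    have e2 := LinearMap.map_add₂ A.bracket ⟨OmniSec.b n F V X, hX⟩ ⟨OmniSec.b n F V X', hX'⟩
      ⟨OmniSec.b n F V Y, hY⟩
    rw [e1, map_add, h Y hY, h' Y hY, ← map_add]
    exact congrArg (fun a : A.Sections => evT m a.1) e2.symm
  zero_mem' := by
    refine ⟨0, by rw [map_zero]; exact zero_mem _, map_zero _, fun Y hY => ?_⟩
    have e2 := LinearMap.map_zero₂ A.bracket ⟨OmniSec.b n F V Y, hY⟩
    have e1 : OmniSec.b n F V (.dorfman 0 Y) = 0 := by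
      simpa using OmniSec.b_dorfman_smul 0 0 Y
    rw [e1]
    exact congrArg (fun a : A.Sections => evT m a.1) e2.symm
  smul_mem' := by
    rintro c _ ⟨X, hX, rfl, h⟩
    refine ⟨c • X, fun m => by
      have : OmniSec.b n F V (c • X) = c • OmniSec.b n F V X := rfl
      rw [this, map_smul]; exact (A.fiber m).smul_mem c (hX m), map_smul _ _ _, fun Y hY => ?_⟩
    have e2 := LinearMap.map_smul₂ A.bracket c ⟨OmniSec.b n F V X, hX⟩
      ⟨OmniSec.b n F V Y, hY⟩
    rw [OmniSec.b_dorfman_smul, map_smul, h Y hY, ← map_smul]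
    exact congrArg (fun a : A.Sections => evT m a.1) e2.symm

end ProjLieAlgebroid

/-! ## Dirac structures and the cohomology of their representation on `E` -/

variable (n F V) in
/-- A Dirac structure of `𝓔`: a maximal isotropic subbundle `L` (i.e. `L = L^⊥`) whose sections are
closed under the Dorfman bracket. -/
structure DiracStructure where
  /-- the fibres `L_m ⊂ 𝓔_m` -/
  fiber : ∀ m : M, Submodule ℝ (OmniFiber n F V m)
  isSubbundle : IsSubbundle (Γ := OmniSec n F V) ev fiber
  eq_orthogonal : ∀ (m : M) (X : OmniSec n F V),
    ev m X ∈ fiber m ↔ ∀ Y : OmniSec n F V, ev m Y ∈ fiber m → X.pairing Y m = 0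
  dorfman_mem : ∀ X ∈ omniSections fiber, ∀ Y ∈ omniSections fiber,
    OmniSec.dorfman X Y ∈ omniSections fiber

namespace DiracStructure

variable (L : DiracStructure n F V)

/-- `Γ(L)`. -/
abbrev Sections := OmniSections L.fiber

/-- The normalizer `N_L`. -/
def normalizer : Set (OmniSec n F V) :=
  {X | ∀ Y ∈ omniSections L.fiber, OmniSec.dorfman X Y ∈ omniSections L.fiber}

/-- The Lie algebroid bracket of `L`, the restriction of the Dorfman bracket. -/
def bracket (l₁ l₂ : L.Sections) : L.Sections :=
  ⟨OmniSec.dorfman l₁.1 l₂.1, L.dorfman_mem _ l₁.2 _ l₂.2⟩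

/-- The representation `ρ_L : L → 𝔇E`. -/
def rep (l : L.Sections) : GaugeSec n F V := l.1.1

/-- The `1`-cochains `Γ(Hom(L, E))`. -/
abbrev Cochain1 := L.Sections →ₗ[SmoothFn n M] Sec n F V

/-- The coboundary of a `0`-cochain: `(d_L u)(l) = ρ_L(l) u`. -/
def d0 : Sec n F V →ₗ[ℝ] L.Cochain1 where
  toFun u :=
    { toFun := fun l => (L.rep l).op u
      map_add' := fun _ _ => rfl
      map_smul' := fun _ _ => rfl }
  map_add' u v := by ext1 l; exact map_add (L.rep l).op u v
  map_smul' c u := by ext1 l; exact map_smul (L.rep l).op c u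

/-- The coboundary of a `1`-cochain:
`(d_L η)(l₁, l₂) = ρ_L(l₁) η(l₂) - ρ_L(l₂) η(l₁) - η([l₁, l₂])`. -/
def d1 : L.Cochain1 →ₗ[ℝ] (L.Sections → L.Sections → Sec n F V) where
  toFun η l₁ l₂ := (L.rep l₁).op (η l₂) - (L.rep l₂).op (η l₁) - η (L.bracket l₁ l₂)
  map_add' η θ := by funext l₁ l₂; simp; abel
  map_smul' c η := by funext l₁ l₂; simp [smul_sub]

theorem d1_d0 (u : Sec n F V) : L.d1 (L.d0 u) = 0 := by
  funext l₁ l₂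
  exact sub_self _

/-- `1`-cocycles. -/
def Z1 : Submodule ℝ L.Cochain1 := LinearMap.ker L.d1

/-- `1`-coboundaries. -/
def B1 : Submodule ℝ L.Cochain1 := LinearMap.range L.d0

/-- The first cohomology `H¹(L, ρ_L)`. -/
abbrev H1 := ↥L.Z1 ⧸ L.B1.submoduleOf L.Z1

/-- The cohomology class of a `1`-cocycle. -/
def toH1 : ↥L.Z1 →ₗ[ℝ] L.H1 := (L.B1.submoduleOf L.Z1).mkQ

/-- The `1`-cochain `ω_X = (X, ·)_E` on `L` attached to a section `X` of `𝓔`. -/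
def omega (X : OmniSec n F V) : L.Cochain1 where
  toFun l := X.pairing l.1
  map_add' l₁ l₂ := by
    change (1 / 2 : ℝ) • _ = (1 / 2 : ℝ) • _ + (1 / 2 : ℝ) • _
    rw [← smul_add]
    congr 1
    change l₁.1.2.pair X.1 + l₂.1.2.pair X.1 + X.2.pair (l₁.1.1 + l₂.1.1) = _
    rw [JetSec.pair_add]
    abel
  map_smul' f l := by
    change (1 / 2 : ℝ) • _ = f • (1 / 2 : ℝ) • _
    rw [smul_comm f]
    congr 1
    change f • l.1.2.pair X.1 + X.2.pair (f • l.1.1) = _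
    rw [JetSec.pair_fsmul, ← smul_add]

end DiracStructure

end Omni

end OmniLie

end

set_option linter.unusedSectionVars false

noncomputable section

namespace OmniLie

/-! ## Modules of sections of vector bundles -/

section Evaluation

open Topology

variable {n : ℕ} {M : Type*} [TopologicalSpace M] [ChartedSpace (EuclideanSpace ℝ (Fin n)) M]

/-! The argument works with falling operators instead of the vectors of 𝓔. A section X enters only
through 𝐛X and the operator X̲ on Γ(𝓣), and in these terms the structure of 𝓔 is simple. The falling
of {X, Y} is the commutator of X̲ and Y̲ (`falling_dorfman`). Twice (X, Y)_E is the E-component of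
X̲(𝐛Y) + Y̲(𝐛X) (`two_smul_pairing`). The kernel of 𝐛 is Hom(𝓣, E), where S acts by t ↦ (0, S t). A
jet 𝕕u falls to zero.

The sections of L^A are the X with 𝐛X = a ∈ Γ(A) and X̲ = [a, ·]_A on Γ(A) (`IsLift`,
`exists_isLift_iff`). Closure under the Dorfman bracket is then the Jacobi identity, and isotropy is
skewness of the bracket of A. For maximality, pairing X with the tensors that vanish on A forces 𝐛X
into A at the given point (here E needs positive rank). After subtraction of a lift, the remaining
tensor must vanish on A, hence lies in L^A. A local frame of L^A consists of lifts of a frame of A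
together with elementary tensors of Hom(𝓣/A, E).

Invariance of the form gives (d_L ω_X)(l₁, l₂) = -({X, l₁}, l₂)_E (`d1_omega`), so that statement 1
is L = L^⊥. For 2, d_L u = ω_{2𝕕u}, hence ω_X = d_L u means X - 2𝕕u ∈ Γ(L); since jets fall to zero,
X falls to some [a, ·]_A on A. Conversely, such an X differs from a lift of a by a jet and a tensor
vanishing on A.

For 3, a derivation δ is compatible with the anchor (`Der.anchor`), hence is the restriction of some
X̲ (`exists_falling`). The commutator of δ with [c, ·]_A is [δc, ·]_A, which puts X in N_L.
Statement 2, applied to differences, gives both independence of the choice and injectivity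
(`toH1_cocycle_eq_iff`). -/

/-- Evaluation of a smooth function at a point. -/
def evFn (m : M) : SmoothFn n M →ₗ[ℝ] ℝ where
  toFun f := f m
  map_add' _ _ := rfl
  map_smul' _ _ := rfl

@[simp] theorem evFn_apply (m : M) (f : SmoothFn n M) : evFn m f = f m := rfl

theorem SmoothFn.sum_apply {ι : Type*} (s : Finset ι) (f : ι → SmoothFn n M) (m : M) :
    (∑ i ∈ s, f i) m = ∑ i ∈ s, f i m :=
  map_sum (evFn (n := n) m) f s

/-- Smooth bump functions. -/
theorem exists_bump [T2Space M] [IsManifold (𝓡 n) ∞ M] {m₀ : M} {U : Set M} (hU : U ∈ 𝓝 m₀) :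
    ∃ χ : SmoothFn n M, (∀ᶠ m in 𝓝 m₀, χ m = 1) ∧ tsupport χ ⊆ U ∧
      ∀ m, 0 ≤ χ m ∧ χ m ≤ 1 := by
  obtain ⟨f, -, hf⟩ := (SmoothBumpFunction.nhds_basis_tsupport (I := 𝓡 n) m₀).mem_iff.1 hU
  exact ⟨⟨f, f.contMDiff⟩, f.eventuallyEq_one, hf, fun m => ⟨f.nonneg, f.le_one⟩⟩

/-- A smooth function which does not vanish at a point is invertible near that point. -/
theorem exists_local_inverse [T2Space M] [IsManifold (𝓡 n) ∞ M] {m₀ : M} (f : SmoothFn n M)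
    (hf : f m₀ ≠ 0) : ∃ h : SmoothFn n M, ∀ᶠ m in 𝓝 m₀, h m * f m = 1 := by
  have hU : {m | f m ≠ 0} ∈ 𝓝 m₀ := f.contMDiff.continuous.continuousAt.eventually_ne hf
  obtain ⟨χ, h1, h2, h3⟩ := exists_bump (n := n) hU
  -- The denominator f² + (1 - χ) has no zero, because χ vanishes wherever f does, and it equals f²
  -- where χ = 1.
  have hpos : ∀ m, f m * f m + (1 - χ m) ≠ 0 := by
    intro m
    by_cases hm : f m = 0
    · have : χ m = 0 := image_eq_zero_of_notMem_tsupport fun h => h2 h hm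
      simp [hm, this]
    · have := mul_self_pos.2 hm
      have := (h3 m).2
      linarith
  have hs : ContMDiff (𝓡 n) 𝓘(ℝ) ∞ fun m => f m * f m + (1 - χ m) :=
    (f.contMDiff.mul f.contMDiff).add (contMDiff_const.sub χ.contMDiff)
  refine ⟨⟨fun m => f m / (f m * f m + (1 - χ m)), f.contMDiff.div₀ hs hpos⟩, ?_⟩
  filter_upwards [h1, hU] with m hm hm'
  change f m / (f m * f m + (1 - χ m)) * f m = 1
  rw [hm]
  have : f m ≠ 0 := hm'
  field_simp
  simp

variable {Γ : Type*} [AddCommGroup Γ] [Module ℝ Γ] [Module (SmoothFn n M) Γ]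
  [IsScalarTower ℝ (SmoothFn n M) Γ]
  {P : M → Type*} [∀ m, AddCommGroup (P m)] [∀ m, Module ℝ (P m)]

/-- A local frame at `m₀` made of global sections, with coefficients in that frame given by global
`C^∞(M)`-linear functionals. -/
structure DualFrame (n : ℕ) [ChartedSpace (EuclideanSpace ℝ (Fin n)) M]
    [Module (SmoothFn n M) Γ] (e : ∀ m : M, Γ →ₗ[ℝ] P m) (m₀ : M) where
  /-- the index type -/
  ι : Type
  fintype : Fintype ι
  /-- the sections of the frame -/
  vec : ι → Γ
  /-- the coefficients -/
  coeff : ι → Γ →ₗ[SmoothFn n M] SmoothFn n M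
  /-- the neighbourhood on which `vec` is a frame -/
  nhd : Set M
  nhd_mem : nhd ∈ 𝓝 m₀
  linearIndependent : ∀ m ∈ nhd, LinearIndependent ℝ fun i => e m (vec i)
  span : ∀ m ∈ nhd, Submodule.span ℝ (Set.range fun i => e m (vec i)) = ⊤
  expand : ∀ m ∈ nhd, ∀ s, e m s = ∑ i, coeff i s m • e m (vec i)

attribute [instance] DualFrame.fintype

/-- The properties of evaluations of sections of a vector bundle which are used here. -/
structure IsSectionModule (n : ℕ) [ChartedSpace (EuclideanSpace ℝ (Fin n)) M]
    [Module (SmoothFn n M) Γ] (e : ∀ m : M, Γ →ₗ[ℝ] P m) : Prop where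
  smul : ∀ m (f : SmoothFn n M) s, e m (f • s) = f m • e m s
  ext : ∀ s t, (∀ m, e m s = e m t) → s = t
  frame : ∀ m₀, Nonempty (DualFrame n e m₀)
  glue : ∀ (ρ : SmoothPartitionOfUnity M (𝓡 n) M Set.univ) (s : M → Γ),
    ∃ t, ∀ m, e m t = ∑ i ∈ ρ.finsupport m, ρ i m • e m (s i)

namespace IsSectionModule

variable [T2Space M] [IsManifold (𝓡 n) ∞ M] {e : ∀ m : M, Γ →ₗ[ℝ] P m}
  {Γ' : Type*} [AddCommGroup Γ'] [Module ℝ Γ'] [Module (SmoothFn n M) Γ']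
  [IsScalarTower ℝ (SmoothFn n M) Γ']
  {P' : M → Type*} [∀ m, AddCommGroup (P' m)] [∀ m, Module ℝ (P' m)] {e' : ∀ m : M, Γ' →ₗ[ℝ] P' m}

/-- Tensoriality: a `C^∞(M)`-linear map on sections acts pointwise. -/
theorem map_eq_zero (he : IsSectionModule n e)
    (he' : ∀ m (f : SmoothFn n M) s, e' m (f • s) = f m • e' m s)
    (Q : Γ →ₗ[SmoothFn n M] Γ') {m : M} {s : Γ} (hs : e m s = 0) : e' m (Q s) = 0 := by
  obtain ⟨Fr⟩ := he.frame m
  obtain ⟨χ, h1, h2, -⟩ := exists_bump (n := n) Fr.nhd_mem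
  -- Cutting off by χ turns the local expansion of s into a global one, to which C^∞(M)-linearity
  -- applies.
  have key : χ • s = ∑ i, (χ * Fr.coeff i s) • Fr.vec i := by
    refine he.ext _ _ fun p => ?_
    rw [he.smul, map_sum]
    by_cases hp : p ∈ Fr.nhd
    · rw [Fr.expand p hp s, Finset.smul_sum]
      refine Finset.sum_congr rfl fun i _ => ?_
      rw [he.smul, smul_smul]
      rfl
    · have : χ p = 0 := image_eq_zero_of_notMem_tsupport fun h => hp (h2 h)
      rw [this, zero_smul]
      refine (Finset.sum_eq_zero fun i _ => ?_).symm
      rw [he.smul]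
      simp [this]
  have hm := mem_of_mem_nhds Fr.nhd_mem
  have hc : ∀ i, Fr.coeff i s m = 0 := by
    have := Fr.expand m hm s
    rw [hs] at this
    exact Fintype.linearIndependent_iff.1 (Fr.linearIndependent m hm) _ this.symm
  have h3 : e' m (Q (χ • s)) = 0 := by
    rw [key, map_sum, map_sum]
    refine Finset.sum_eq_zero fun i _ => ?_
    rw [map_smul, he']
    simp [hc]
  rwa [map_smul, he', h1.self_of_nhds, one_smul] at h3

theorem map_eq (he : IsSectionModule n e)
    (he' : ∀ m (f : SmoothFn n M) s, e' m (f • s) = f m • e' m s)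
    (Q : Γ →ₗ[SmoothFn n M] Γ') {m : M} {s t : Γ} (hs : e m s = e m t) :
    e' m (Q s) = e' m (Q t) := by
  rw [← sub_eq_zero, ← map_sub, ← map_sub]
  exact he.map_eq_zero he' Q (by rw [map_sub, hs, sub_self])

theorem functional_eq (he : IsSectionModule n e) (Q : Γ →ₗ[SmoothFn n M] SmoothFn n M) {m : M}
    {s t : Γ} (hs : e m s = e m t) : Q s m = Q t m :=
  he.map_eq (e' := evFn) (fun _ _ _ => rfl) Q hs

/-- Every vector extends to a section. -/
theorem surjective (he : IsSectionModule n e) (m : M) : Function.Surjective (e m) := by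
  obtain ⟨Fr⟩ := he.frame m
  rw [← LinearMap.range_eq_top, ← top_le_iff, ← Fr.span m (mem_of_mem_nhds Fr.nhd_mem),
    Submodule.span_le]
  rintro _ ⟨i, rfl⟩
  exact ⟨_, rfl⟩

/-- Sections which are independent at a point have, near this point, a dual system of
functionals. -/
theorem exists_dual (he : IsSectionModule n e) {m₀ : M} {κ : Type} [Fintype κ] [DecidableEq κ]
    (t : κ → Γ) (ht : LinearIndependent ℝ fun i => e m₀ (t i)) :
    ∃ g : κ → Γ →ₗ[SmoothFn n M] SmoothFn n M,
      ∀ᶠ m in 𝓝 m₀, ∀ i j, g i (t j) m = if i = j then 1 else 0 := by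
  classical
  obtain ⟨Fr⟩ := he.frame m₀
  let B : Matrix Fr.ι κ (SmoothFn n M) := Matrix.of fun l j => Fr.coeff l (t j)
  let B₀ : Matrix Fr.ι κ ℝ := B.map (evFn m₀)
  have hB : LinearIndependent ℝ B₀.col := by
    rw [Fintype.linearIndependent_iff] at ht ⊢
    intro c hc
    refine ht c ?_
    have h1 : ∀ l, ∑ j, c j * Fr.coeff l (t j) m₀ = 0 := fun l => by
      simpa [B₀, B] using congrFun hc l
    simp_rw [Fr.expand m₀ (mem_of_mem_nhds Fr.nhd_mem) (t _), Finset.smul_sum, smul_smul]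
    rw [Finset.sum_comm]
    simp_rw [← Finset.sum_smul, h1, zero_smul, Finset.sum_const_zero]
  -- A left inverse of the coefficient matrix at m₀, kept constant in m: the square matrix G = C B
  -- is then the identity at m₀ and invertible near it.
  obtain ⟨C₀, hC₀⟩ : ∃ C₀ : Matrix κ Fr.ι ℝ, C₀ * B₀ = 1 := by
    have hinj : LinearMap.ker (Matrix.toLin' B₀) = ⊥ :=
      LinearMap.ker_eq_bot.2 (Matrix.mulVec_injective_iff.2 hB)
    obtain ⟨g, hg⟩ := LinearMap.exists_leftInverse_of_injective _ hinj
    refine ⟨LinearMap.toMatrix' g, ?_⟩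
    rw [← LinearMap.toMatrix'_toLin' B₀, ← LinearMap.toMatrix'_comp, hg, LinearMap.toMatrix'_id]
  let C : Matrix κ Fr.ι (SmoothFn n M) := C₀.map (algebraMap ℝ (SmoothFn n M))
  let G : Matrix κ κ (SmoothFn n M) := C * B
  have hG₀ : G.map (evFn m₀) = 1 := by
    rw [← hC₀]
    ext i j
    simp only [G, B₀, Matrix.map_apply, Matrix.mul_apply, map_sum]
    rfl
  have hdet : G.det m₀ = 1 := by
    have h2 := RingHom.map_det (ContMDiffMap.evalRingHom m₀ : SmoothFn n M →+* ℝ) G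
    have h3 : (ContMDiffMap.evalRingHom m₀ : SmoothFn n M →+* ℝ).mapMatrix G = 1 := hG₀
    rw [h3, Matrix.det_one] at h2
    exact h2
  obtain ⟨h, hh⟩ := exists_local_inverse G.det (by rw [hdet]; exact one_ne_zero)
  -- Cramer's rule: adj(G) C B = det G, and h inverts det G near m₀.
  refine ⟨fun i => h • ∑ l, (G.adjugate * C) i l • Fr.coeff l, ?_⟩
  filter_upwards [hh] with m hm i j
  have h4 : (∑ l, (G.adjugate * C) i l • Fr.coeff l) (t j) = if i = j then G.det else 0 := by
    have h5 : (∑ l, (G.adjugate * C) i l • Fr.coeff l) (t j) = ((G.adjugate * C) * B) i j := by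
      simp [Matrix.mul_apply, LinearMap.sum_apply, B]
    rw [h5, Matrix.mul_assoc, show C * B = G from rfl, Matrix.adjugate_mul]
    simp [Matrix.one_apply]
  rw [LinearMap.smul_apply, h4]
  split_ifs
  · exact hm
  · simp

/-- A dual system of functionals forces independence. -/
theorem linearIndependent_of_dual (he : IsSectionModule n e) {m : M} {κ : Type} [Fintype κ]
    [DecidableEq κ] {t : κ → Γ} {g : κ → Γ →ₗ[SmoothFn n M] SmoothFn n M}
    (h : ∀ i j, g i (t j) m = if i = j then 1 else 0) : LinearIndependent ℝ fun i => e m (t i) := by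
  rw [Fintype.linearIndependent_iff]
  intro c hc i
  have h1 : e m (∑ j, c j • t j) = e m 0 := by simpa using hc
  have h2 := he.functional_eq (g i) h1
  rw [map_sum, SmoothFn.sum_apply] at h2
  simpa [h] using h2

/-- Expansion of the vectors in the span of a system which has a dual system. -/
theorem expand_of_dual (he : IsSectionModule n e) {m : M} {κ : Type} [Fintype κ]
    [DecidableEq κ] {t : κ → Γ} {g : κ → Γ →ₗ[SmoothFn n M] SmoothFn n M}
    (h : ∀ i j, g i (t j) m = if i = j then 1 else 0) {s : Γ}
    (hs : e m s ∈ Submodule.span ℝ (Set.range fun i => e m (t i))) :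
    e m s = ∑ i, g i s m • e m (t i) := by
  obtain ⟨c, hc⟩ := (Submodule.mem_span_range_iff_exists_fun ℝ).1 hs
  have h1 : e m s = e m (∑ j, c j • t j) := by simpa using hc.symm
  have h2 : ∀ i, g i s m = c i := fun i => by
    rw [he.functional_eq (g i) h1, map_sum, SmoothFn.sum_apply]
    simp [h]
  simp_rw [h2]
  exact hc.symm

/-- Sections which are independent at a point extend to a local frame. -/
theorem exists_extension (he : IsSectionModule n e) {m₀ : M} {k : ℕ}
    (t : Fin k → Γ) (ht : LinearIndependent ℝ fun i => e m₀ (t i)) :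
    ∃ (l : ℕ) (c : Fin l → Γ) (g : Fin k ⊕ Fin l → Γ →ₗ[SmoothFn n M] SmoothFn n M),
      ∀ᶠ m in 𝓝 m₀, (∀ i j, g i (Sum.elim t c j) m = if i = j then 1 else 0) ∧
        ∀ s, e m s = ∑ i, g i s m • e m (Sum.elim t c i) := by
  classical
  obtain ⟨Fr⟩ := he.frame m₀
  have hm₀ := mem_of_mem_nhds Fr.nhd_mem
  have hfr : ∀ m ∈ Fr.nhd, Module.finrank ℝ (P m) = Fintype.card Fr.ι := fun m hm =>
    Module.finrank_eq_card_basis (Module.Basis.mk (Fr.linearIndependent m hm) (Fr.span m hm).ge)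
  have hfin : ∀ m ∈ Fr.nhd, FiniteDimensional ℝ (P m) := fun m hm =>
    (Module.Basis.mk (Fr.linearIndependent m hm) (Fr.span m hm).ge).finiteDimensional_of_finite
  have := hfin m₀ hm₀
  obtain ⟨W, hW⟩ := (Submodule.span ℝ (Set.range fun i => e m₀ (t i))).exists_isCompl
  let bW := Module.finBasis ℝ W
  choose c hc using fun j => he.surjective m₀ (bW j : P m₀)
  have hbW : LinearIndependent ℝ fun j => e m₀ (c j) := by
    simp_rw [hc]
    exact bW.linearIndependent.map' W.subtype W.ker_subtype
  have hspW : Submodule.span ℝ (Set.range fun j => e m₀ (c j)) = W := by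
    simp_rw [hc]
    rw [show (fun j => (bW j : P m₀)) = W.subtype ∘ bW from rfl, Set.range_comp,
      Submodule.span_image, bW.span_eq, Submodule.map_top, Submodule.range_subtype]
  have hli : LinearIndependent ℝ fun i => e m₀ (Sum.elim t c i) := by
    have := ht.sum_type hbW (by rw [hspW]; exact hW.disjoint)
    rwa [show Sum.elim (fun i => e m₀ (t i)) (fun j => e m₀ (c j)) =
      fun i => e m₀ (Sum.elim t c i) by ext1 i; cases i <;> rfl] at this
  have hcard : Fintype.card (Fin k ⊕ Fin (Module.finrank ℝ W)) = Fintype.card Fr.ι := by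
    rw [← hfr m₀ hm₀, ← Submodule.finrank_add_eq_of_isCompl hW, finrank_span_eq_card ht]
    simp
  obtain ⟨g, hg⟩ := he.exists_dual _ hli
  refine ⟨_, c, g, ?_⟩
  filter_upwards [hg, Fr.nhd_mem] with m hm hm'
  refine ⟨hm, fun s => he.expand_of_dual hm ?_⟩
  have := hfin m hm'
  -- Nearby fibres have the dimension of the fibre at m₀, so independence of this many vectors
  -- suffices.
  rw [(he.linearIndependent_of_dual hm).span_eq_top_of_card_eq_finrank' (hcard.trans (hfr m hm').symm)]
  trivial

/-! ### Gluing by partitions of unity. -/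

variable [SigmaCompactSpace M]

/-- Gluing of `C^∞(M)`-linear maps by a partition of unity. -/
theorem exists_glue (he' : IsSectionModule n e') (U : M → Set M) (hU : ∀ m, U m ∈ 𝓝 m)
    {D : Type*} (Q : M → D → Γ →ₗ[SmoothFn n M] Γ') :
    ∃ ρ : SmoothPartitionOfUnity M (𝓡 n) M Set.univ,
      (∀ m, ∀ i ∈ ρ.finsupport m, m ∈ U i) ∧
      ∃ G : D → Γ →ₗ[SmoothFn n M] Γ', ∀ d m s,
        e' m (G d s) = ∑ i ∈ ρ.finsupport m, ρ i m • e' m (Q i d s) := by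
  obtain ⟨ρ, hρ⟩ := SmoothPartitionOfUnity.exists_isSubordinate (𝓡 n) isClosed_univ
    (fun m => interior (U m)) (fun m => isOpen_interior) (fun m _ =>
      Set.mem_iUnion.2 ⟨m, mem_interior_iff_mem_nhds.2 (hU m)⟩)
  refine ⟨ρ, fun m i hi => ?_, ?_⟩
  · rw [ρ.mem_finsupport] at hi
    exact interior_subset (hρ i (subset_closure hi))
  · choose t ht using fun (d : D) (s : Γ) => he'.glue ρ fun i => Q i d s
    refine ⟨fun d => { toFun := t d, map_add' := fun s s' => ?_, map_smul' := fun f s => ?_ },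
      fun d m s => ht d s m⟩
    · refine he'.ext _ _ fun m => ?_
      simp [ht, Finset.sum_add_distrib]
    · refine he'.ext _ _ fun m => ?_
      simp [ht, he'.smul, Finset.smul_sum, smul_comm (f m)]

/-- A subbundle is the image of a projector. -/
theorem exists_projector (he : IsSectionModule n e) (A : ∀ m, Submodule ℝ (P m))
    (hA : IsSubbundle e A) : ∃ p : Γ →ₗ[SmoothFn n M] Γ, (∀ m s, e m (p s) ∈ A m) ∧
      ∀ m s, e m s ∈ A m → e m (p s) = e m s := by
  have hloc : ∀ m₀, ∃ U ∈ 𝓝 m₀, ∃ q : Γ →ₗ[SmoothFn n M] Γ, ∀ m ∈ U,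
      (∀ s, e m (q s) ∈ A m) ∧ ∀ s, e m s ∈ A m → e m (q s) = e m s := by
    intro m₀
    obtain ⟨k, t, ht⟩ := hA m₀
    obtain ⟨g, hg⟩ := he.exists_dual t ht.self_of_nhds.1
    refine ⟨_, ht.and hg, ∑ i, (g i).smulRight (t i), fun m hm => ?_⟩
    obtain ⟨⟨h1, h2⟩, h3⟩ := hm
    have h4 : ∀ s, e m ((∑ i, (g i).smulRight (t i)) s) = ∑ i, g i s m • e m (t i) := fun s => by
      simp [LinearMap.sum_apply, he.smul]
    refine ⟨fun s => ?_, fun s hs => ?_⟩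
    · rw [h4, ← h2]
      exact Submodule.sum_mem _ fun i _ => Submodule.smul_mem _ _ (Submodule.subset_span ⟨i, rfl⟩)
    · rw [h4, ← he.expand_of_dual h3 (by rw [h2]; exact hs)]
  choose U hU q hq using hloc
  -- Having values in A and being the identity on A are both preserved by convex combinations, so
  -- local projectors may be averaged.
  obtain ⟨ρ, hρ, G, hG⟩ := he.exists_glue U hU fun i (_ : Unit) => q i
  refine ⟨G (), fun m s => ?_, fun m s hs => ?_⟩
  · rw [hG]
    exact Submodule.sum_mem _ fun i hi => Submodule.smul_mem _ _ ((hq i m (hρ m i hi)).1 s)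
  · rw [hG, Finset.sum_congr rfl fun i hi => by rw [(hq i m (hρ m i hi)).2 s hs],
      ← Finset.sum_smul, ρ.sum_finsupport m (Set.mem_univ m), one_smul]

end IsSectionModule

end Evaluation

/-! ### Sections of E and 𝓣, and connections. -/

section Bundles

open Topology

variable {n : ℕ} {M : Type*} [TopologicalSpace M] [ChartedSpace (EuclideanSpace ℝ (Fin n)) M]
  {F : Type*} [NormedAddCommGroup F] [NormedSpace ℝ F]
  {V : M → Type*} [TopologicalSpace (Bundle.TotalSpace F V)] [∀ m, AddCommGroup (V m)]
  [∀ m, Module ℝ (V m)] [∀ m, TopologicalSpace (V m)] [FiberBundle F V] [VectorBundle ℝ F V]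

/-- Evaluation of a section of a vector bundle at a point. -/
def evSec (m : M) : Sec n F V →ₗ[ℝ] V m where
  toFun u := u m
  map_add' _ _ := rfl
  map_smul' _ _ := rfl

@[simp] theorem evSec_apply (m : M) (u : Sec n F V) : evSec m u = u m := rfl

variable [T2Space M] [IsManifold (𝓡 n) ∞ M] [FiniteDimensional ℝ F]
  [ContMDiffVectorBundle ∞ F V (𝓡 n)]

/-- A bump function supported in the domain of a trivialization multiplies both its local frame and
the coefficient functions, which makes them global and changes nothing where the bump is 1. -/
theorem exists_dualFrame (m₀ : M) : Nonempty (DualFrame n (evSec (n := n) (F := F) (V := V)) m₀) := by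
  have : ContMDiffVectorBundle 1 F V (𝓡 n) := ContMDiffVectorBundle.of_le (n := ∞) (by simp)
  let t := trivializationAt F V m₀
  let b := Module.finBasis ℝ F
  have hm₀ : m₀ ∈ t.baseSet := FiberBundle.mem_baseSet_trivializationAt' m₀
  obtain ⟨χ, h1, h2, -⟩ := exists_bump (n := n) (t.open_baseSet.mem_nhds hm₀)
  have hb : ∀ m, χ m = 1 → m ∈ t.baseSet := fun m hm => h2 (subset_closure (by simp [hm]))
  let vec : Fin (Module.finrank ℝ F) → Sec n F V := fun i =>
    ⟨fun m => χ m • t.localFrame b i m, χ.contMDiff.contMDiffOn.smul_section_of_tsupport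
      t.open_baseSet h2 (t.contMDiffOn_localFrame_baseSet ∞ b i)⟩
  let coeff : Fin (Module.finrank ℝ F) → Sec n F V →ₗ[SmoothFn n M] SmoothFn n M := fun i =>
    { toFun := fun s => ⟨fun m => χ m * t.localFrameCoeff (𝓡 n) b i m (s m), by
        refine contMDiff_of_tsupport fun m hm => ?_
        have hm' : m ∈ t.baseSet := h2 (tsupport_mul_subset_left hm)
        exact χ.contMDiff.contMDiffAt.mul
          (contMDiffAt_localFrameCoeff b hm' (s.contMDiff m) i)⟩
      map_add' := fun s s' => by
        ext m
        change χ m * _ = χ m * _ + χ m * _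
        rw [← mul_add, ← map_add]
        rfl
      map_smul' := fun f s => by
        ext m
        change χ m * t.localFrameCoeff (𝓡 n) b i m (f m • s m) = f m * (χ m * _)
        rw [map_smul, smul_eq_mul]
        ring }
  have hvec : ∀ m, χ m = 1 → (fun i => evSec m (vec i)) = fun i => t.localFrame b i m :=
    fun m hm => by
      ext1 i
      change χ m • t.localFrame b i m = _
      rw [hm, one_smul]
  have hfr := t.isLocalFrameOn_localFrame_baseSet (𝓡 n) ∞ b
  refine ⟨⟨_, inferInstance, vec, coeff, {m | χ m = 1}, h1, fun m hm => ?_, fun m hm => ?_,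
    fun m hm s => ?_⟩⟩
  · rw [hvec m hm]
    exact hfr.linearIndependent (hb m hm)
  · rw [hvec m hm]
    exact top_le_iff.1 (hfr.generating (hb m hm))
  · rw [show ∑ i, coeff i s m • evSec m (vec i) = ∑ i, coeff i s m • t.localFrame b i m from
      Finset.sum_congr rfl fun i _ => by rw [congrFun (hvec m hm) i]]
    have h3 : ∀ i, coeff i s m = t.localFrameCoeff (𝓡 n) b i m (s m) := fun i => by
      change χ m * _ = _
      rw [show χ m = 1 from hm, one_mul]
    simp_rw [h3]
    exact t.eq_sum_localFrameCoeff_smul (s := s) (hb m hm)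

theorem isSectionModule_sec : IsSectionModule n (evSec (n := n) (F := F) (V := V)) where
  smul _ _ _ := rfl
  ext s t h := by ext m; exact h m
  frame := exists_dualFrame
  glue ρ s := by
    refine ⟨⟨fun m => ∑ᶠ i, ρ i m • s i m, ?_⟩, fun m => ?_⟩
    · refine ContMDiff.finsum_section_of_locallyFinite ?_ fun i =>
        (ρ i).contMDiff.smul_section (s i).contMDiff
      exact ρ.locallyFinite.subset fun i m hm => left_ne_zero_of_smul hm
    · have hsub : (Function.support fun i => ρ i m • s i m) ⊆ (ρ.finsupport m : Set M) := by
        intro i hi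
        rw [ρ.coe_finsupport]
        exact left_ne_zero_of_smul hi
      exact finsum_eq_sum_of_support_subset _ hsub

theorem isSectionModule_vField :
    IsSectionModule n fun m : M =>
      (evSec m : VField n M →ₗ[ℝ] (TangentSpace (𝓡 n) m)) :=
  isSectionModule_sec

theorem isSectionModule_tSec :
    IsSectionModule n fun m : M => (evT m : TSec n F V →ₗ[ℝ] TFiber n V m) where
  smul _ _ _ := rfl
  ext s t h := Prod.ext (isSectionModule_vField.ext _ _ fun m => congrArg Prod.fst (h m))
    (isSectionModule_sec.ext _ _ fun m => congrArg Prod.snd (h m))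
  frame m₀ := by
    obtain ⟨A⟩ := (isSectionModule_vField (n := n) (M := M)).frame m₀
    obtain ⟨B⟩ := (isSectionModule_sec (n := n) (F := F) (V := V)).frame m₀
    have hAB : ∀ m, (fun i => evT m (Sum.elim (fun i => ((A.vec i, 0) : TSec n F V))
        (fun i => (0, B.vec i)) i)) = Sum.elim
          (LinearMap.inl ℝ (TangentSpace (𝓡 n) m) (V m) ∘ fun i => evSec m (A.vec i))
          (LinearMap.inr ℝ (TangentSpace (𝓡 n) m) (V m) ∘ fun i => evSec m (B.vec i)) := fun m => by
      ext1 i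
      cases i <;> rfl
    refine ⟨⟨A.ι ⊕ B.ι, inferInstance,
      Sum.elim (fun i => (A.vec i, 0)) (fun i => (0, B.vec i)),
      Sum.elim (fun i => A.coeff i ∘ₗ LinearMap.fst _ _ _)
        (fun i => B.coeff i ∘ₗ LinearMap.snd _ _ _),
      A.nhd ∩ B.nhd, Filter.inter_mem A.nhd_mem B.nhd_mem, fun m hm => ?_, fun m hm => ?_,
      fun m hm s => ?_⟩⟩
    · rw [hAB]
      exact linearIndependent_inl_union_inr' (A.linearIndependent m hm.1)
        (B.linearIndependent m hm.2)
    · rw [hAB, Set.Sum.elim_range, Submodule.span_union, Set.range_comp, Set.range_comp,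
        Submodule.span_image, Submodule.span_image, A.span m hm.1, B.span m hm.2, Submodule.map_top,
        Submodule.map_top]
      exact LinearMap.isCompl_range_inl_inr.sup_eq_top
    · have h1 : ∑ i, A.coeff i s.1 m • evT m ((A.vec i, 0) : TSec n F V) =
          LinearMap.inl ℝ (TangentSpace (𝓡 n) m) (V m) (evSec m s.1) := by
        rw [A.expand m hm.1 s.1, map_sum]
        exact Finset.sum_congr rfl fun i _ => by rw [map_smul]; rfl
      have h2 : ∑ i, B.coeff i s.2 m • evT m ((0, B.vec i) : TSec n F V) =
          LinearMap.inr ℝ (TangentSpace (𝓡 n) m) (V m) (evSec m s.2) := by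
        rw [B.expand m hm.2 s.2, map_sum]
        exact Finset.sum_congr rfl fun i _ => by rw [map_smul]; rfl
      rw [Fintype.sum_sum_type]
      refine Eq.trans ?_ (congrArg₂ (· + ·) h1 h2).symm
      exact Prod.ext (add_zero _).symm (zero_add _).symm
  glue ρ s := by
    obtain ⟨t₁, h₁⟩ := isSectionModule_vField.glue ρ fun i => (s i).1
    obtain ⟨t₂, h₂⟩ := isSectionModule_sec.glue ρ fun i => (s i).2
    refine ⟨(t₁, t₂), fun m => Prod.ext ?_ ?_⟩
    · rw [Prod.fst_sum]
      exact h₁ m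
    · rw [Prod.snd_sum]
      exact h₂ m

variable (n F V) in
/-- Existence of a connection on a vector bundle. -/
theorem exists_connection [SigmaCompactSpace M] :
    ∃ C : VField n M →ₗ[SmoothFn n M] GaugeSec n F V, ∀ x, (C x).symbol = x := by
  have hF := isSectionModule_sec (n := n) (F := F) (V := V)
  let Fr := fun m => Classical.choice (hF.frame m)
  -- The flat connection of the frame at i, ∇_x u = ∑ x(uʲ) eⱼ. It satisfies the Leibniz rule only
  -- where the frame expands u; a partition of unity subordinate to these neighbourhoods averages
  -- the choices.
  let Q : M → Sec n F V → VField n M →ₗ[SmoothFn n M] Sec n F V := fun i u =>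
    { toFun := fun x => ∑ j, x.app ((Fr i).coeff j u) • (Fr i).vec j
      map_add' := fun x y => by simp [add_smul, Finset.sum_add_distrib]
      map_smul' := fun f x => by simp [mul_smul, Finset.smul_sum] }
  have hQ : ∀ i u x m, Q i u x m = ∑ j, x.app ((Fr i).coeff j u) m • (Fr i).vec j m :=
    fun i u x m => by
      have := map_sum (evSec m) (fun j => x.app ((Fr i).coeff j u) • (Fr i).vec j) Finset.univ
      exact this
  obtain ⟨ρ, hρ, G, hG⟩ := hF.exists_glue (fun i => (Fr i).nhd) (fun i => (Fr i).nhd_mem) Q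
  have hG' : ∀ u x m, G u x m = ∑ i ∈ ρ.finsupport m, ρ i m • Q i u x m := fun u x m => hG u m x
  have app_rsmul : ∀ (x : VField n M) (c : ℝ) f, x.app (c • f) = c • x.app f := fun x c f => by
    have h1 : c • f = algebraMap ℝ (SmoothFn n M) c * f := Algebra.smul_def c f
    have h2 : x.app (algebraMap ℝ (SmoothFn n M) c) = 0 := by
      ext m
      rw [VField.app_apply]
      have : (algebraMap ℝ (SmoothFn n M) c : M → ℝ) = fun _ => c := rfl
      rw [this]
      simp [mvfderiv]
    rw [h1, VField.app_mul, h2, mul_zero, add_zero, Algebra.smul_def]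
  refine ⟨⟨⟨fun x => ⟨(⟨⟨fun u => G u x, fun u v => ?_⟩, fun c u => ?_⟩, x), fun f u => ?_⟩,
    fun x y => ?_⟩, fun f x => ?_⟩, fun x => rfl⟩
  · ext m
    change G (u + v) x m = G u x m + G v x m
    simp only [hG', hQ, ← Finset.sum_add_distrib, ← smul_add]
    simp [VField.app_add_fn, add_smul, Finset.sum_add_distrib]
  · ext m
    change G (c • u) x m = c • G u x m
    have : ∀ i j, (Fr i).coeff j (c • u) = c • (Fr i).coeff j u := fun i j =>
      LinearMap.map_smul_of_tower _ _ _
    simp only [hG', hQ, this, app_rsmul, Finset.smul_sum]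
    refine Finset.sum_congr rfl fun i _ => Finset.sum_congr rfl fun j _ => ?_
    change ρ i m • (c * _) • _ = _
    module
  · ext m
    change G (f • u) x m = x.app f m • u m + f m • G u x m
    have key : ∀ i ∈ ρ.finsupport m, ρ i m • Q i (f • u) x m =
        ρ i m • (x.app f m • u m) + f m • ρ i m • Q i u x m := by
      intro i hi
      have h1 := (Fr i).expand m (hρ m i hi) u
      rw [smul_comm (f m), ← smul_add]
      congr 1
      simp only [evSec_apply] at h1
      rw [hQ, hQ, h1, Finset.smul_sum, Finset.smul_sum, ← Finset.sum_add_distrib]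
      refine Finset.sum_congr rfl fun j _ => ?_
      rw [map_smul, smul_eq_mul, VField.app_mul]
      change (f m * _ + _ * x.app f m) • _ = _
      module
    rw [hG', hG', Finset.sum_congr rfl key, Finset.sum_add_distrib, ← Finset.sum_smul,
      ρ.sum_finsupport m (Set.mem_univ m), one_smul, Finset.smul_sum]
  · exact GaugeSec.ext (fun u => map_add (G u) x y) rfl
  · exact GaugeSec.ext (fun u => map_smul (G u) f x) rfl

end Bundles

/-! ## The falling operators -/

section Falling

variable {n : ℕ} {M : Type*} [TopologicalSpace M] [ChartedSpace (EuclideanSpace ℝ (Fin n)) M]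
  {F : Type*} [NormedAddCommGroup F] [NormedSpace ℝ F]
  {V : M → Type*} [TopologicalSpace (Bundle.TotalSpace F V)] [∀ m, AddCommGroup (V m)]
  [∀ m, Module ℝ (V m)] [∀ m, TopologicalSpace (V m)] [FiberBundle F V] [VectorBundle ℝ F V]
  [T2Space M] [SigmaCompactSpace M] [IsManifold (𝓡 n) ∞ M] [FiniteDimensional ℝ F]
  [ContMDiffVectorBundle ∞ F V (𝓡 n)]

variable (n F V) in
/-- A chosen connection of the bundle. -/
def conn : VField n M →ₗ[SmoothFn n M] GaugeSec n F V := (exists_connection n F V).choose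

@[simp] theorem conn_symbol (x : VField n M) : (conn n F V x).symbol = x :=
  (exists_connection n F V).choose_spec x

variable (n F V) in
/-- The `C^∞(M)`-linear splitting of `𝐛` given by a connection. -/
def split : TSec n F V →ₗ[SmoothFn n M] OmniSec n F V where
  toFun t := (conn n F V t.1,
    -- The jet 𝕕u is a lift of u, but not C^∞(M)-linear in u; subtracting 𝔡 ↦ ∇_{α(𝔡)} u, which
    -- vanishes on gl(E), makes it so.
    ⟨{ toFun := fun d => d.op t.2 - (conn n F V d.symbol).op t.2
       map_add' := fun d r => by simp; abel
       map_smul' := fun f d => by simp [smul_sub] }, fun Φ h => by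
        change Φ.op t.2 - (conn n F V Φ.symbol).op t.2 =
          Φ.op (t.2 - (conn n F V (0 : VField n M)).op t.2)
        have h0 : (0 : GaugeSec n F V).op t.2 = 0 := rfl
        rw [h, map_zero, h0, sub_zero, sub_zero]⟩)
  map_add' s t := by
    refine Prod.ext (map_add _ _ _) (JetSec.ext fun d => ?_)
    change d.op (s.2 + t.2) - (conn n F V d.symbol).op (s.2 + t.2) =
      (d.op s.2 - (conn n F V d.symbol).op s.2) + (d.op t.2 - (conn n F V d.symbol).op t.2)
    rw [map_add, map_add]
    abel
  map_smul' f t := by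
    refine Prod.ext (map_smul _ _ _) (JetSec.ext fun d => ?_)
    change d.op (f • t.2) - (conn n F V d.symbol).op (f • t.2) =
      f • (d.op t.2 - (conn n F V d.symbol).op t.2)
    rw [GaugeSec.op_smul, GaugeSec.op_smul, conn_symbol]
    module

open OmniSec

@[simp] theorem split_fst (t : TSec n F V) : (split n F V t).1 = conn n F V t.1 := rfl

@[simp] theorem split_proj (t : TSec n F V) : (split n F V t).2.proj = t.2 := by
  change t.2 - (conn n F V (0 : VField n M)).op t.2 = t.2
  have h0 : (0 : GaugeSec n F V).op t.2 = 0 := rfl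
  rw [map_zero, h0, sub_zero]

@[simp] theorem b_split (t : TSec n F V) : b n F V (split n F V t) = t :=
  Prod.ext (conn_symbol _) (split_proj _)

/-- The connection supplies a canonical lift of t, and thus a closed formula instead of an arbitrary
choice. -/
theorem falling_eq (X : OmniSec n F V) (t : TSec n F V) :
    falling X t = (X.1.symbol.lie t.1,
      X.1.op t.2 - (conn n F V t.1).op X.2.proj + X.2.pair (conn n F V t.1)) := by
  conv_lhs => rw [← b_split t]
  rw [falling_b, b_dorfman]
  simp

theorem falling_fst (X : OmniSec n F V) (t : TSec n F V) :
    (falling X t).1 = X.1.symbol.lie t.1 := by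
  rw [falling_eq]

theorem falling_snd (X : OmniSec n F V) (t : TSec n F V) : (falling X t).2 =
    X.1.op t.2 - (conn n F V t.1).op X.2.proj + X.2.pair (conn n F V t.1) := by
  rw [falling_eq]

theorem falling_add_right (X : OmniSec n F V) (s t : TSec n F V) :
    falling X (s + t) = falling X s + falling X t := by
  refine Prod.ext ?_ ?_
  · simp only [falling_fst, Prod.fst_add, VField.lie_add]
  · simp only [falling_snd, Prod.snd_add, Prod.fst_add, map_add, GaugeSec.op_add, JetSec.pair_add]
    abel

theorem falling_smul_right (X : OmniSec n F V) (f : SmoothFn n M) (t : TSec n F V) :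
    falling X (f • t) = X.1.symbol.app f • t + f • falling X t := by
  refine Prod.ext ?_ ?_
  · simp only [falling_fst, Prod.fst_add, Prod.smul_fst, VField.lie_smul]
  · simp only [falling_snd, Prod.snd_add, Prod.smul_fst, Prod.smul_snd, map_smul,
      GaugeSec.op_smul, GaugeSec.op_fsmul, JetSec.pair_fsmul]
    module

theorem falling_add_left (X Y : OmniSec n F V) (t : TSec n F V) :
    falling (X + Y) t = falling X t + falling Y t := by
  conv_lhs => rw [← b_split t]
  rw [falling_b, b_dorfman_add, ← falling_b, ← falling_b, b_split]

theorem falling_rsmul_left (c : ℝ) (X : OmniSec n F V) (t : TSec n F V) :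
    falling (c • X) t = c • falling X t := by
  conv_lhs => rw [← b_split t]
  rw [falling_b, b_dorfman_smul, ← falling_b, b_split]

theorem falling_sub_left (X Y : OmniSec n F V) (t : TSec n F V) :
    falling (X - Y) t = falling X t - falling Y t := by
  rw [eq_sub_iff_add_eq, ← falling_add_left, sub_add_cancel]

theorem falling_sub_right (X : OmniSec n F V) (s t : TSec n F V) :
    falling X (s - t) = falling X s - falling X t := by
  rw [eq_sub_iff_add_eq, ← falling_add_right, sub_add_cancel]

/-- The defect of linearity in X is the same as that of a ↦ [a, c]_A in `smul_bracket`; comparing a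
falling with a bracket is therefore tensorial. -/
theorem falling_smul_left (f : SmoothFn n M) (X : OmniSec n F V) (t : TSec n F V) :
    falling (f • X) t = f • falling X t - t.1.app f • b n F V X := by
  refine Prod.ext ?_ ?_
  · change _ = f • (falling X t).1 - t.1.app f • X.1.symbol
    rw [falling_fst, falling_fst, VField.lie_swap]
    change -t.1.lie (f • X.1.symbol) = _
    rw [VField.lie_smul, VField.lie_swap X.1.symbol]
    module
  · change _ = f • (falling X t).2 - t.1.app f • X.2.proj
    rw [falling_snd, falling_snd]
    change f • X.1.op t.2 - (conn n F V t.1).op (f • X.2.proj) + f • X.2.pair (conn n F V t.1) = _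
    rw [GaugeSec.op_smul, conn_symbol]
    module

/-- The falling of the Dorfman bracket is the commutator. -/
theorem falling_dorfman (X Y : OmniSec n F V) (t : TSec n F V) :
    falling (dorfman X Y) t = falling X (falling Y t) - falling Y (falling X t) := by
  obtain ⟨Z, rfl⟩ : ∃ Z, b n F V Z = t := ⟨_, b_split t⟩
  rw [falling_b, falling_b, falling_b, falling_b, falling_b]
  have hp : ∀ A B : OmniSec n F V, (dorfman A B).2.proj =
      A.1.op B.2.proj - B.1.op A.2.proj + A.2.pair B.1 := fun A B =>
    congrArg Prod.snd (b_dorfman A B)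
  have hq : ∀ A B : OmniSec n F V, ∀ d, (dorfman A B).2.pair d =
      (A.1.op (B.2.pair d) - B.2.pair (A.1.lie d)) - (B.1.op (A.2.pair d) - A.2.pair (B.1.lie d))
        + d.op (A.2.pair B.1) := fun _ _ _ => rfl
  have h1 : ∀ A B : OmniSec n F V, (dorfman A B).1 = A.1.lie B.1 := fun _ _ => rfl
  rw [b_dorfman, b_dorfman, b_dorfman]
  refine Prod.ext ?_ ?_
  · simp only [h1, GaugeSec.lie_symbol, Prod.fst_sub]
    rw [VField.lie_jacobi X.1.symbol, add_sub_cancel_right]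
  · simp only [h1, hp, hq, GaugeSec.lie_op, Prod.snd_sub, map_add, map_sub]
    abel

/-- The polarization of the pairing by the falling operators. -/
theorem pairing_eq_falling (X Y : OmniSec n F V) : X.pairing Y =
    (1 / 2 : ℝ) • ((falling X (b n F V Y)).2 + (falling Y (b n F V X)).2) := by
  rw [falling_b, falling_b, b_dorfman, b_dorfman, OmniSec.pairing]
  change _ = (1 / 2 : ℝ) • ((X.1.op Y.2.proj - Y.1.op X.2.proj + X.2.pair Y.1) +
    (Y.1.op X.2.proj - X.1.op Y.2.proj + Y.2.pair X.1))
  congr 1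
  abel

theorem two_smul_pairing (X Y : OmniSec n F V) : (2 : ℝ) • X.pairing Y =
    (falling X (b n F V Y)).2 + (falling Y (b n F V X)).2 := by
  rw [pairing_eq_falling, smul_smul]
  norm_num

/-! ### The kernel of 𝐛 as Hom(𝓣, E). -/

variable (n F V) in
/-- The section of `𝓔` with vanishing projection to `𝓣` attached to a tensor in `Hom(𝓣, E)`. -/
def ofTensor (S : TSec n F V →ₗ[SmoothFn n M] Sec n F V) : OmniSec n F V :=
  (⟨(⟨⟨fun v => S (0, v), fun u v => by rw [← map_add]; simp⟩, fun c u => by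
      rw [RingHom.id_apply, ← LinearMap.map_smul_of_tower]; simp⟩, 0), fun f u => by
      change S (0, f • u) = (0 : VField n M).app f • u + f • S (0, u)
      rw [VField.zero_app, zero_smul, zero_add, ← map_smul]
      simp⟩,
   ⟨{ toFun := fun d => S (d.symbol, 0)
      map_add' := fun d r => by rw [← map_add]; simp
      map_smul' := fun f d => by rw [RingHom.id_apply, ← map_smul]; simp }, fun Φ h => by
        change S (Φ.symbol, 0) = Φ.op (S (0, 0))
        have h0 : ((0, 0) : TSec n F V) = 0 := rfl
        rw [h, h0, map_zero, map_zero]⟩)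

@[simp] theorem b_ofTensor (S : TSec n F V →ₗ[SmoothFn n M] Sec n F V) :
    b n F V (ofTensor n F V S) = 0 :=
  Prod.ext rfl (map_zero S)

@[simp] theorem ofTensor_symbol (S : TSec n F V →ₗ[SmoothFn n M] Sec n F V) :
    (ofTensor n F V S).1.symbol = 0 := rfl

@[simp] theorem falling_ofTensor (S : TSec n F V →ₗ[SmoothFn n M] Sec n F V) (t : TSec n F V) :
    falling (ofTensor n F V S) t = (0, S t) := by
  obtain ⟨Y, rfl⟩ : ∃ Y, b n F V Y = t := ⟨_, b_split t⟩
  rw [falling_b, b_dorfman]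
  refine Prod.ext (by simp) ?_
  change S (0, Y.2.proj) - Y.1.op (S 0) + S (Y.1.symbol, 0) = S (Y.1.symbol, Y.2.proj)
  rw [map_zero, map_zero, sub_zero, ← map_add]
  simp

/-- The falling of a section with vanishing projection to `𝓣` is a tensor. -/
def tensorOf (X : OmniSec n F V) (hX : b n F V X = 0) :
    TSec n F V →ₗ[SmoothFn n M] Sec n F V where
  toFun t := (falling X t).2
  map_add' s t := by rw [falling_add_right]; rfl
  map_smul' f t := by
    have h : X.1.symbol = 0 := congrArg Prod.fst hX
    rw [falling_smul_right, h, VField.zero_app, zero_smul, zero_add]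
    rfl

/-! ### Evaluation at a point -/

theorem ev_eq_zero {m : M} {X : OmniSec n F V} : ev m X = 0 ↔
    X.1.symbol m = 0 ∧ (∀ u, X.1.op u m = 0) ∧ ∀ d, X.2.pair d m = 0 :=
  Submodule.Quotient.mk_eq_zero _

theorem evT_b_eq_zero {m : M} {X : OmniSec n F V} (h : ev m X = 0) : evT m (b n F V X) = 0 := by
  obtain ⟨h1, -, h3⟩ := ev_eq_zero.1 h
  exact Prod.ext h1 (h3 _)

theorem ev_split {m : M} {t : TSec n F V} (h : evT m t = 0) : ev m (split n F V t) = 0 :=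
  isSectionModule_tSec.map_eq_zero (e' := fun m : M => (ev m : OmniSec n F V →ₗ[ℝ] _)) ev_smul _ h

/-- Arguments (0, u) detect the gl(E) part of X and arguments (α(𝔡), 0) its jet part. -/
theorem ev_eq_zero_of_b_eq_zero {m : M} {X : OmniSec n F V} (hX : b n F V X = 0)
    (h : ∀ t, evT m (falling X t) = 0) : ev m X = 0 := by
  have hx : X.1.symbol = 0 := congrArg Prod.fst hX
  have hu : X.2.proj = 0 := congrArg Prod.snd hX
  refine ev_eq_zero.2 ⟨by rw [hx]; rfl, fun u => ?_, fun d => ?_⟩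
  · have h1 : (falling X (0, u)).2 m = 0 := congrArg Prod.snd (h (0, u))
    rw [falling_snd, hu, map_zero, map_zero] at h1
    have h2 : X.2.pair 0 = 0 := map_zero X.2.1
    rwa [h2, sub_zero, add_zero] at h1
  · have h1 : (falling X (b n F V (d, 0))).2 m = 0 := congrArg Prod.snd (h _)
    rw [falling_b, b_dorfman, hu] at h1
    have h2 : JetSec.proj (0 : JetSec n F V) = 0 := rfl
    simp only [h2, map_zero] at h1
    rwa [sub_zero, zero_add] at h1

theorem falling_eq_zero {m : M} {X : OmniSec n F V} (hX : b n F V X = 0) (h : ev m X = 0)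
    (t : TSec n F V) : evT m (falling X t) = 0 := by
  have hx : X.1.symbol = 0 := congrArg Prod.fst hX
  have hu : X.2.proj = 0 := congrArg Prod.snd hX
  obtain ⟨-, h2, h3⟩ := ev_eq_zero.1 h
  rw [falling_eq, hx, hu, map_zero, sub_zero, VField.zero_lie]
  refine Prod.ext rfl ?_
  change X.1.op t.2 m + X.2.pair (conn n F V t.1) m = 0
  rw [h2, h3, add_zero]

theorem pairing_comm (X Y : OmniSec n F V) : X.pairing Y = Y.pairing X := by
  rw [OmniSec.pairing, OmniSec.pairing, add_comm]

/-- Fibres of 𝓔 are quotients of spaces of sections, and this is what lets the form descend to them.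
-/
theorem pairing_apply_eq_zero {m : M} {Y : OmniSec n F V} (h : ev m Y = 0) (X : OmniSec n F V) :
    X.pairing Y m = 0 := by
  obtain ⟨h1, h2, h3⟩ := ev_eq_zero.1 h
  -- `Y.1` is split into its horizontal part, controlled by the symbol, and a section of gl(E), on
  -- which a jet is determined by its projection to E.
  have key : X.2.pair Y.1 = X.2.pair (conn n F V Y.1.symbol) +
      (Y.1.op X.2.proj - (conn n F V Y.1.symbol).op X.2.proj) := by
    have h4 : (Y.1 - conn n F V Y.1.symbol).symbol = 0 := by simp
    have h5 := JetSec.pair_gl X.2 h4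
    rw [JetSec.pair_sub, GaugeSec.op_sub] at h5
    rw [← h5, add_sub_cancel]
  have h6 : X.2.pair (conn n F V Y.1.symbol) m = 0 :=
    isSectionModule_vField.map_eq_zero (e' := fun m : M => (evSec m : Sec n F V →ₗ[ℝ] V m))
      (fun _ _ _ => rfl) (X.2.1 ∘ₗ conn n F V) h1
  have h7 : (conn n F V Y.1.symbol).op X.2.proj m = 0 :=
    isSectionModule_vField.map_eq_zero (e' := fun m : M => (evSec m : Sec n F V →ₗ[ℝ] V m))
      (fun _ _ _ => rfl) ((JetSec.jet X.2.proj).1 ∘ₗ conn n F V) h1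
  change (1 / 2 : ℝ) • (Y.2.pair X.1 m + X.2.pair Y.1 m) = 0
  rw [key, h3]
  change (1 / 2 : ℝ) • (0 + (X.2.pair (conn n F V Y.1.symbol) m +
    (Y.1.op X.2.proj m - (conn n F V Y.1.symbol).op X.2.proj m))) = 0
  rw [h6, h7, h2]
  simp

theorem pairing_add_right (X Y Z : OmniSec n F V) :
    X.pairing (Y + Z) = X.pairing Y + X.pairing Z := by
  change (1 / 2 : ℝ) • (Y.2.pair X.1 + Z.2.pair X.1 + X.2.pair (Y.1 + Z.1)) =
    (1 / 2 : ℝ) • _ + (1 / 2 : ℝ) • _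
  rw [JetSec.pair_add]
  module

theorem pairing_sub_right (X Y Z : OmniSec n F V) :
    X.pairing (Y - Z) = X.pairing Y - X.pairing Z := by
  rw [eq_sub_iff_add_eq, ← pairing_add_right, sub_add_cancel]

theorem pairing_congr_right {m : M} {Y Z : OmniSec n F V} (h : ev m Y = ev m Z)
    (X : OmniSec n F V) : X.pairing Y m = X.pairing Z m := by
  have h1 : ev m (Y - Z) = 0 := by rw [map_sub, h, sub_self]
  have h2 : (X.pairing Y - X.pairing Z) m = 0 := by
    rw [← pairing_sub_right]; exact pairing_apply_eq_zero h1 X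
  exact sub_eq_zero.1 h2

theorem pairing_congr {m : M} {X X' Y Y' : OmniSec n F V} (hX : ev m X = ev m X')
    (hY : ev m Y = ev m Y') : X.pairing Y m = X'.pairing Y' m := by
  rw [pairing_congr_right hY, pairing_comm, pairing_congr_right hX, pairing_comm]

/-! ### Behaviour with respect to the jet prolongation -/

/-- The jet prolongation `𝕕 u` as a section of `𝓔`. -/
def jetSec (u : Sec n F V) : OmniSec n F V := (0, JetSec.jet u)

@[simp] theorem falling_jetSec (u : Sec n F V) (t : TSec n F V) : falling (jetSec u) t = 0 := by
  have h0 : ∀ v, (0 : GaugeSec n F V).op v = 0 := fun _ => rfl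
  have h1 : (0 : GaugeSec n F V).symbol = 0 := rfl
  have h2 : (JetSec.jet u).proj = u := rfl
  rw [jetSec, falling_eq, h0, h1, h2, VField.zero_lie, JetSec.jet_pair, zero_sub, neg_add_cancel]
  rfl

theorem pairing_jetSec (u : Sec n F V) (X : OmniSec n F V) :
    OmniSec.pairing (jetSec u) X = (1 / 2 : ℝ) • X.1.op u := by
  have h : X.2.pair 0 = 0 := map_zero X.2.1
  rw [jetSec, OmniSec.pairing, h, zero_add, JetSec.jet_pair]

/-- Invariance of the pairing. -/
theorem op_pairing (X Y Z : OmniSec n F V) : X.1.op (Y.pairing Z) =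
    (dorfman X Y).pairing Z + Y.pairing (dorfman X Z) := by
  simp only [OmniSec.pairing, dorfman, map_smul, map_add, JetSec.add_pair, JetSec.sub_pair,
    JetSec.lieDeriv_pair, JetSec.jet_pair]
  have h : ∀ (μ : JetSec n F V) (d r : GaugeSec n F V), μ.pair (d.lie r) = - μ.pair (r.lie d) := by
    intro μ d r
    have h1 : d.lie r + r.lie d = 0 := by
      refine GaugeSec.ext (fun u => ?_) ?_
      · change _ - _ + (_ - _) = (0 : Sec n F V)
        abel
      · change d.symbol.lie r.symbol + r.symbol.lie d.symbol = 0
        rw [VField.lie_swap, neg_add_cancel]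
    rw [eq_neg_iff_add_eq_zero, ← JetSec.pair_add, h1]
    exact map_zero μ.1
  -- The only terms that do not cancel directly are the pairings of `X.2` with the two opposite
  -- commutators of `Y.1` and `Z.1`.
  rw [h X.2 Z.1 Y.1]
  module

/-- Commutators and Lie derivatives cancel in {X, Y} + {Y, X}; only the two jet terms survive. -/
theorem dorfman_swap (X Y : OmniSec n F V) : dorfman Y X =
    (2 : ℝ) • jetSec (X.pairing Y) - dorfman X Y := by
  refine Prod.ext (GaugeSec.ext (fun u => ?_) ?_) (JetSec.ext fun d => ?_)
  · change Y.1.op (X.1.op u) - X.1.op (Y.1.op u) = (2 : ℝ) • (0 : Sec n F V) -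
      (X.1.op (Y.1.op u) - Y.1.op (X.1.op u))
    rw [smul_zero]
    abel
  · change Y.1.symbol.lie X.1.symbol = (2 : ℝ) • (0 : VField n M) - X.1.symbol.lie Y.1.symbol
    rw [VField.lie_swap, smul_zero, zero_sub]
  · change _ - _ + d.op _ = (2 : ℝ) • d.op ((1 / 2 : ℝ) • _) - (_ - _ + d.op _)
    rw [map_smul, smul_smul, map_add]
    norm_num
    abel

end Falling

/-! ## The lift of a projective Lie algebroid -/

namespace ProjLieAlgebroid

open OmniSec Topology

variable {n : ℕ} {M : Type*} [TopologicalSpace M] [ChartedSpace (EuclideanSpace ℝ (Fin n)) M]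
  {F : Type*} [NormedAddCommGroup F] [NormedSpace ℝ F]
  {V : M → Type*} [TopologicalSpace (Bundle.TotalSpace F V)] [∀ m, AddCommGroup (V m)]
  [∀ m, Module ℝ (V m)] [∀ m, TopologicalSpace (V m)] [FiberBundle F V] [VectorBundle ℝ F V]
  [T2Space M] [SigmaCompactSpace M] [IsManifold (𝓡 n) ∞ M] [FiniteDimensional ℝ F]
  [ContMDiffVectorBundle ∞ F V (𝓡 n)] (A : ProjLieAlgebroid n F V)

/-- A projector of `Γ(𝓣)` onto `Γ(A)`. -/
def projector : TSec n F V →ₗ[SmoothFn n M] TSec n F V :=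
  (isSectionModule_tSec.exists_projector A.fiber A.isSubbundle).choose

theorem projector_mem (t : TSec n F V) : A.projector t ∈ tSections A.fiber := fun m =>
  (isSectionModule_tSec.exists_projector A.fiber A.isSubbundle).choose_spec.1 m t

theorem evT_projector {m : M} {t : TSec n F V} (ht : evT m t ∈ A.fiber m) :
    evT m (A.projector t) = evT m t :=
  (isSectionModule_tSec.exists_projector A.fiber A.isSubbundle).choose_spec.2 m t ht

theorem projector_eq {t : TSec n F V} (ht : t ∈ tSections A.fiber) : A.projector t = t :=
  isSectionModule_tSec.ext _ _ fun m => A.evT_projector (ht m)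

variable {A} in
/-- A section of `𝓣` with values in `A`, as an element of `Γ(A)`. -/
def ofMem {t : TSec n F V} (ht : t ∈ tSections A.fiber) : A.Sections := ⟨t, ht⟩

variable {A} in
theorem sections_ext {a c : A.Sections} (h : a.1 = c.1) : a = c := Subtype.ext h

/-- The projector, with values in `Γ(A)`. -/
def toSections : TSec n F V →ₗ[SmoothFn n M] A.Sections where
  toFun t := ⟨A.projector t, A.projector_mem t⟩
  map_add' s t := Subtype.ext (map_add A.projector s t)
  map_smul' f t := Subtype.ext (map_smul A.projector f t)

@[simp] theorem toSections_coe (t : TSec n F V) : (A.toSections t).1 = A.projector t := rfl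

theorem toSections_eq (a : A.Sections) : A.toSections a.1 = a := Subtype.ext (A.projector_eq a.2)

theorem bracket_swap (a c : A.Sections) : A.bracket a c = - A.bracket c a := by
  have h := A.bracket_self (a + c)
  rw [map_add, map_add, LinearMap.add_apply, LinearMap.add_apply, A.bracket_self,
    A.bracket_self, zero_add, add_zero] at h
  rw [eq_neg_iff_add_eq_zero, add_comm]
  exact h

theorem smul_bracket (f : SmoothFn n M) (a c : A.Sections) :
    A.bracket (f • a) c = f • A.bracket a c - c.1.1.app f • a := by
  rw [A.bracket_swap, A.leibniz, A.bracket_swap a c]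
  module

/-- An operator on `Γ(A)` compatible with the anchor is the restriction of a falling operator. -/
theorem exists_falling (t₀ : TSec n F V) (δ : A.Sections →ₗ[ℝ] A.Sections)
    (hδ : ∀ (f : SmoothFn n M) a, δ (f • a) = t₀.1.app f • a + f • δ a)
    (hfst : ∀ a, (δ a).1.1 = t₀.1.lie a.1.1) :
    ∃ X, b n F V X = t₀ ∧ ∀ a : A.Sections, falling X a.1 = (δ a).1 := by
  let S := split n F V t₀
  have hS : S.1.symbol = t₀.1 := conn_symbol _
  -- On Γ(A), δ and the falling of S have the same symbol and the same TM-component, so their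
  -- difference is a tensor A → E. The projector extends it to 𝓣.
  let T : TSec n F V →ₗ[SmoothFn n M] Sec n F V :=
    { toFun := fun t => (δ (A.toSections t)).1.2 - (falling S (A.projector t)).2
      map_add' := fun s t => by
        rw [map_add, map_add, map_add, falling_add_right]
        change (δ (A.toSections s)).1.2 + (δ (A.toSections t)).1.2 -
          ((falling S (A.projector s)).2 + (falling S (A.projector t)).2) = _
        abel
      map_smul' := fun f t => by
        rw [map_smul A.toSections, map_smul A.projector, hδ, falling_smul_right, hS]
        change t₀.1.app f • (A.projector t).2 + f • (δ (A.toSections t)).1.2 -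
          (t₀.1.app f • (A.projector t).2 + f • (falling S (A.projector t)).2) = f • (_ - _)
        module }
  refine ⟨S + ofTensor n F V T, by rw [map_add, b_split, b_ofTensor, add_zero], fun a => ?_⟩
  rw [falling_add_left, falling_ofTensor]
  refine Prod.ext ?_ ?_
  · change (falling S a.1).1 + 0 = _
    rw [falling_fst, hS, add_zero, hfst]
  · change (falling S a.1).2 + ((δ (A.toSections a.1)).1.2 - (falling S (A.projector a.1)).2) = _
    rw [toSections_eq, A.projector_eq a.2]
    abel

/-- `X` is a section of the lift `L^A` over the section `a` of `A`. -/
def IsLift (X : OmniSec n F V) (a : A.Sections) : Prop :=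
  b n F V X = a.1 ∧ ∀ c : A.Sections, falling X c.1 = (A.bracket a c).1

theorem exists_isLift (a : A.Sections) : ∃ X, A.IsLift X a :=
  A.exists_falling a.1 (A.bracket a) (fun f c => A.leibniz a c f) (A.anchor_bracket a)

variable {A}

theorem IsLift.add {X Y : OmniSec n F V} {a c : A.Sections} (hX : A.IsLift X a)
    (hY : A.IsLift Y c) : A.IsLift (X + Y) (a + c) := by
  refine ⟨by rw [map_add, hX.1, hY.1]; rfl, fun d => ?_⟩
  rw [falling_add_left, hX.2, hY.2, map_add]
  rfl

/-- Sections of Hom(𝓣/A, E), which serve below as test sections, as correction terms and as part of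
a frame. -/
theorem isLift_ofTensor {S : TSec n F V →ₗ[SmoothFn n M] Sec n F V}
    (hS : ∀ a : A.Sections, S a.1 = 0) : A.IsLift (ofTensor n F V S) 0 := by
  refine ⟨b_ofTensor S, fun c => ?_⟩
  rw [falling_ofTensor, hS, map_zero]
  rfl

/-- The lift is closed under the Dorfman bracket. -/
theorem IsLift.dorfman {X Y : OmniSec n F V} {a c : A.Sections} (hX : A.IsLift X a)
    (hY : A.IsLift Y c) : A.IsLift (dorfman X Y) (A.bracket a c) := by
  refine ⟨by rw [← falling_b, hY.1, hX.2], fun d => ?_⟩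
  rw [falling_dorfman, hY.2, hX.2, hX.2, hY.2, A.jacobi a c d]
  exact add_sub_cancel_right (A.bracket (A.bracket a c) d).1 _

theorem IsLift.ev_mem {X : OmniSec n F V} {a : A.Sections} (hX : A.IsLift X a) (m : M) :
    ev m X ∈ A.liftFiber m := by
  refine ⟨X, by rw [hX.1]; exact a.2, rfl, fun Y hY => ?_⟩
  rw [← falling_b]
  have h := hX.2 ⟨b n F V Y, hY⟩
  rw [show a = ofMem (by rw [hX.1]; exact a.2) from sections_ext hX.1.symm] at h
  exact congrArg (evT m) h

/-- A criterion of membership in the lift at a point. -/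
theorem ev_mem_liftFiber {m : M} {X : OmniSec n F V} (hX : b n F V X ∈ tSections A.fiber)
    (h : ∀ c : A.Sections, evT m (falling X c.1) = evT m (A.bracket (ofMem hX) c).1) :
    ev m X ∈ A.liftFiber m :=
  ⟨X, hX, rfl, fun Y hY => by rw [← falling_b]; exact h (ofMem hY)⟩

/-- Every vector of the lift extends to a section of the lift. -/
theorem exists_isLift_ev {m : M} {ξ : OmniFiber n F V m} (hξ : ξ ∈ A.liftFiber m) :
    ∃ X a, A.IsLift X a ∧ ev m X = ξ := by
  obtain ⟨X, hX, rfl, h⟩ := hξ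
  obtain ⟨Y, hY⟩ := A.exists_isLift (ofMem hX)
  have hZ : b n F V (X - Y) = 0 := by rw [map_sub, hY.1]; exact sub_self _
  let T := tensorOf (X - Y) hZ
  -- The lift Y has the right falling on A; T' adds the part of X - Y off A. What is left is X̲ - Y̲
  -- composed with the projector, which vanishes at m by the hypothesis on X.
  let T' := T ∘ₗ (LinearMap.id - A.projector)
  have hT' : A.IsLift (ofTensor n F V T') 0 := isLift_ofTensor fun a => by
    change T (a.1 - A.projector a.1) = 0
    rw [A.projector_eq a.2, sub_self, map_zero]
  refine ⟨Y + ofTensor n F V T', _, hY.add hT', ?_⟩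
  rw [← sub_eq_zero, ← map_sub, ← neg_eq_zero, ← map_neg]
  have e : -(Y + ofTensor n F V T' - X) = (X - Y) - ofTensor n F V T' := by abel
  rw [e]
  refine ev_eq_zero_of_b_eq_zero (by rw [map_sub, hZ, b_ofTensor, sub_zero]) fun t => ?_
  rw [falling_sub_left, falling_ofTensor]
  have h1 : falling (X - Y) t - (0, T' t) = falling (X - Y) (A.projector t) := by
    refine Prod.ext ?_ ?_
    · have h0 : (X - Y).1.symbol = 0 := congrArg Prod.fst hZ
      rw [Prod.fst_sub, falling_fst, falling_fst, h0, VField.zero_lie, VField.zero_lie, sub_zero]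
    · change T t - T (t - A.projector t) = T (A.projector t)
      rw [map_sub, sub_sub_cancel]
  rw [h1, falling_sub_left]
  have hs : b n F V (split n F V (A.projector t)) ∈ tSections A.fiber := by
    rw [b_split]; exact A.projector_mem t
  have h2 : evT m (b n F V (dorfman X (split n F V (A.projector t)))) =
    evT m (A.bracket (ofMem hX) (ofMem hs)).1 := h _ hs
  rw [show ofMem hs = A.toSections t from sections_ext (b_split _), ← falling_b, b_split] at h2
  rw [map_sub, h2, ← toSections_coe, hY.2, sub_self]

/-- The sections of the lift. -/
theorem exists_isLift_iff {X : OmniSec n F V} :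
    X ∈ omniSections A.liftFiber ↔ ∃ a, A.IsLift X a := by
  refine ⟨fun hX => ?_, fun ⟨a, ha⟩ m => ha.ev_mem m⟩
  have hb : b n F V X ∈ tSections A.fiber := fun m => by
    obtain ⟨Y, a, hY, hm⟩ := exists_isLift_ev (hX m)
    have h0 : ev m (Y - X) = 0 := by rw [map_sub, hm, sub_self]
    have h1 := evT_b_eq_zero h0
    rw [map_sub, map_sub, sub_eq_zero, hY.1] at h1
    rw [← h1]
    exact a.2 m
  refine ⟨ofMem hb, rfl, fun c => isSectionModule_tSec.ext _ _ fun m => ?_⟩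
  obtain ⟨Y, a, hY, hm⟩ := exists_isLift_ev (hX m)
  have h0 : ev m (X - Y) = 0 := by rw [map_sub, hm, sub_self]
  have h1 : evT m (b n F V (X - Y)) = 0 := evT_b_eq_zero h0
  -- The lift Y through X_m depends on m and 𝐛(X - Y) vanishes only at m. K is C^∞(M)-linear, since
  -- the two derivative terms cancel, so it sees only this value and shows that X̲(c) and [𝐛X, c]_A
  -- agree at m.
  let K : TSec n F V →ₗ[SmoothFn n M] TSec n F V :=
    { toFun := fun t => falling (split n F V (A.projector t)) c.1 - (A.bracket (A.toSections t) c).1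
      map_add' := fun s t => by
        rw [map_add, map_add, map_add, map_add, falling_add_left]
        exact add_sub_add_comm _ _ _ _
      map_smul' := fun f t => by
        rw [map_smul, map_smul, map_smul, falling_smul_left, smul_bracket, b_split]
        change f • falling (split n F V (A.projector t)) c.1 - c.1.1.app f • A.projector t -
          (f • (A.bracket (A.toSections t) c).1 - c.1.1.app f • A.projector t) = f • (_ - _)
        module }
  have h2 : evT m (K (b n F V (X - Y))) = 0 :=
    isSectionModule_tSec.map_eq_zero (e' := fun m : M => (evT m : TSec n F V →ₗ[ℝ] TFiber n V m))
      (fun _ _ _ => rfl) K h1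
  have hbZ : b n F V (X - Y) ∈ tSections A.fiber := by
    rw [map_sub, hY.1]; exact sub_mem hb a.2
  have h3 : A.toSections (b n F V (X - Y)) = ofMem hb - a := by
    refine Subtype.ext ?_
    rw [toSections_coe, A.projector_eq hbZ, map_sub, hY.1]
    rfl
  have h4 : evT m (falling (X - Y - split n F V (b n F V (X - Y))) c.1) = 0 := by
    refine falling_eq_zero (by rw [map_sub, b_split, sub_self]) ?_ _
    rw [map_sub, h0, ev_split h1, sub_zero]
  have h5 : K (b n F V (X - Y)) = falling (split n F V (b n F V (X - Y))) c.1 -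
      (A.bracket (A.toSections (b n F V (X - Y))) c).1 := by
    change falling (split n F V (A.projector _)) c.1 - _ = _
    rw [A.projector_eq hbZ]
  rw [h5, h3, map_sub] at h2
  rw [falling_sub_left, map_sub, sub_eq_zero] at h4
  rw [← h4, falling_sub_left, hY.2, map_sub] at h2
  have h6 : (A.bracket (ofMem hb - a) c).1 =
      (A.bracket (ofMem hb) c).1 - (A.bracket a c).1 := by
    rw [map_sub]
    rfl
  rw [h6, map_sub] at h2
  exact sub_eq_zero.1 (by rw [← h2]; abel)

/-- The lift is isotropic. -/
theorem IsLift.pairing_eq_zero {X Y : OmniSec n F V} {a c : A.Sections} (hX : A.IsLift X a)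
    (hY : A.IsLift Y c) : X.pairing Y = 0 := by
  rw [pairing_eq_falling, hX.1, hY.1, hX.2, hY.2, A.bracket_swap c a]
  change (1 / 2 : ℝ) • ((A.bracket a c).1.2 + -(A.bracket a c).1.2) = 0
  rw [add_neg_cancel, smul_zero]

/-- The lift is maximal isotropic. -/
theorem ev_mem_liftFiber_iff [Nontrivial F] (m : M) (X : OmniSec n F V) :
    ev m X ∈ A.liftFiber m ↔ ∀ Y, ev m Y ∈ A.liftFiber m → X.pairing Y m = 0 := by
  refine ⟨fun hX Y hY => ?_, fun h => ?_⟩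
  · obtain ⟨X', a, hX', hm⟩ := exists_isLift_ev hX
    obtain ⟨Y', c, hY', hm'⟩ := exists_isLift_ev hY
    rw [← pairing_congr hm hm', hX'.pairing_eq_zero hY']
    rfl
  · have two : ∀ Y, ev m Y ∈ A.liftFiber m →
        (falling X (b n F V Y)).2 m + (falling Y (b n F V X)).2 m = 0 := fun Y hY => by
      have h1 := congrArg (fun s : Sec n F V => s m) (two_smul_pairing X Y)
      have h2 : (2 : ℝ) • X.pairing Y m = _ := h1
      rw [h Y hY, smul_zero] at h2
      exact h2.symm
    have hb : evT m (b n F V X) = evT m (A.projector (b n F V X)) := by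
      obtain ⟨Fr⟩ := (isSectionModule_tSec (n := n) (F := F) (V := V)).frame m
      obtain ⟨v, hv⟩ : ∃ v : V m, v ≠ 0 := by
        have : Nontrivial (V m) :=
          ((trivializationAt F V m).linearEquivAt ℝ m
            (FiberBundle.mem_baseSet_trivializationAt' m)).toEquiv.nontrivial
        exact exists_ne 0
      obtain ⟨u, hu⟩ := (isSectionModule_sec (n := n) (F := F) (V := V)).surjective m v
      have hc : ∀ i, Fr.coeff i (b n F V X - A.projector (b n F V X)) m = 0 := fun i => by
        -- This tensor kills A, so it belongs to L^A. Its pairing with X reads off the i-th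
        -- coefficient of 𝐛X - p(𝐛X), p being the projector, because u does not vanish at m.
        let S : TSec n F V →ₗ[SmoothFn n M] Sec n F V :=
          (Fr.coeff i).smulRight u ∘ₗ (LinearMap.id - A.projector)
        have hS : A.IsLift (ofTensor n F V S) 0 := isLift_ofTensor fun a => by
          change Fr.coeff i (a.1 - A.projector a.1) • u = 0
          rw [A.projector_eq a.2, sub_self, map_zero, zero_smul]
        have h1 := two _ (hS.ev_mem m)
        have hX0 : (falling X (0 : TSec n F V)).2 m = 0 := by
          have := falling_sub_right X (0 : TSec n F V) 0
          rw [sub_self, sub_self] at this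
          rw [this]
          rfl
        rw [b_ofTensor, falling_ofTensor, hX0, zero_add] at h1
        have h2 : Fr.coeff i (b n F V X - A.projector (b n F V X)) m • u m = 0 := h1
        rw [evSec_apply] at hu
        rw [hu] at h2
        exact (smul_eq_zero.1 h2).resolve_right hv
      rw [← sub_eq_zero, ← map_sub, Fr.expand m (mem_of_mem_nhds Fr.nhd_mem)]
      exact Finset.sum_eq_zero fun i _ => by rw [hc, zero_smul]
    obtain ⟨Y, hY⟩ := A.exists_isLift (A.toSections (b n F V X))
    have h1 : evT m (b n F V (X - Y)) = 0 := by
      rw [map_sub, map_sub, hY.1, hb, toSections_coe, sub_self]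
    -- 𝐛(X - Y) vanishes only at m; subtracting its splitting makes 𝐛Z vanish identically and leaves
    -- the value at m unchanged.
    let Z := X - Y - split n F V (b n F V (X - Y))
    have hZ : b n F V Z = 0 := by rw [map_sub, b_split, sub_self]
    have hevZ : ev m Z = ev m X - ev m Y := by
      rw [map_sub, ev_split h1, sub_zero, map_sub]
    have hmem : ev m Z ∈ A.liftFiber m := by
      refine ev_mem_liftFiber (by rw [hZ]; exact zero_mem _) fun c => ?_
      rw [show ofMem _ = (0 : A.Sections) from sections_ext hZ, map_zero]
      obtain ⟨W, hW⟩ := A.exists_isLift c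
      have h2 : (2 : ℝ) • Z.pairing W m = 0 := by
        have h3 : Z.pairing W m = (X - Y).pairing W m := by
          refine pairing_congr ?_ rfl
          rw [hevZ, map_sub]
        have h4 : (X - Y).pairing W = X.pairing W - Y.pairing W := by
          rw [pairing_comm, pairing_sub_right, pairing_comm W, pairing_comm W]
        rw [h3, h4, hY.pairing_eq_zero hW, sub_zero, h W (hW.ev_mem m), smul_zero]
      have h3 : (2 : ℝ) • Z.pairing W m = _ :=
        congrArg (fun s : Sec n F V => s m) (two_smul_pairing Z W)
      rw [h2, hZ, hW.1] at h3
      have hW0 : (falling W (0 : TSec n F V)).2 = 0 := by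
        have := falling_sub_right W (0 : TSec n F V) 0
        rw [sub_self, sub_self] at this
        rw [this]
        rfl
      rw [hW0, add_zero] at h3
      refine Prod.ext ?_ h3.symm
      have hz : Z.1.symbol = 0 := congrArg Prod.fst hZ
      change (falling Z c.1).1 m = 0
      rw [falling_fst, hz, VField.zero_lie]
      rfl
    have := add_mem hmem (hY.ev_mem m)
    rwa [hevZ, sub_add_cancel] at this

end ProjLieAlgebroid

/-- Smooth functions separate tangent vectors. -/
theorem tangent_eq_zero {n : ℕ} {M : Type*} [TopologicalSpace M]
    [ChartedSpace (EuclideanSpace ℝ (Fin n)) M] [IsManifold (𝓡 n) ∞ M] [T2Space M] {m : M}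
    {v : TangentSpace (𝓡 n) m} (h : ∀ f : SmoothFn n M, mvfderiv (𝓡 n) f m v = 0) : v = 0 := by
  obtain ⟨χ, -, -⟩ :=
    (SmoothBumpFunction.nhds_basis_tsupport (I := 𝓡 n) m).mem_iff.1 Filter.univ_mem
  -- The cut-off chart is globally smooth and has the injective differential of the chart at m; its
  -- components are the test functions.
  let g : M → EuclideanSpace ℝ (Fin n) := fun p => χ p • extChartAt (𝓡 n) m p
  have hg : ContMDiff (𝓡 n) 𝓘(ℝ, EuclideanSpace ℝ (Fin n)) ∞ g :=
    χ.contMDiff_smul contMDiffOn_extChartAt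
  have hgm := hg.mdifferentiable (by simp) m
  have heq : g =ᶠ[nhds m] extChartAt (𝓡 n) m := by
    filter_upwards [χ.eventuallyEq_one] with p hp
    change χ p • _ = _
    rw [hp, Pi.one_apply, one_smul]
  have hinj : Function.Injective (mfderiv (𝓡 n) 𝓘(ℝ, EuclideanSpace ℝ (Fin n)) g m) := by
    rw [heq.mfderiv_eq]
    exact (isInvertible_mfderiv_extChartAt (mem_extChartAt_source m)).injective
  apply hinj
  rw [map_zero]
  refine PiLp.ext fun i => ?_
  let p : EuclideanSpace ℝ (Fin n) →L[ℝ] ℝ := EuclideanSpace.proj i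
  have hf : ContMDiff (𝓡 n) 𝓘(ℝ) ∞ (p ∘ g) := p.contMDiff.comp hg
  have h1 := h ⟨p ∘ g, hf⟩
  have h2 : mfderiv (𝓡 n) 𝓘(ℝ) (p ∘ g) m =
      (mfderiv 𝓘(ℝ, EuclideanSpace ℝ (Fin n)) 𝓘(ℝ) p (g m)).comp
        (mfderiv (𝓡 n) 𝓘(ℝ, EuclideanSpace ℝ (Fin n)) g m) :=
    mfderiv_comp m p.mdifferentiableAt hgm
  rw [ContinuousLinearMap.mfderiv_eq] at h2
  exact (congrArg (fun l => l v) h2).symm.trans h1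

/-! ### Derivations and the anchor; a local frame of L^A. -/

namespace ProjLieAlgebroid

open OmniSec Topology

variable {n : ℕ} {M : Type*} [TopologicalSpace M] [ChartedSpace (EuclideanSpace ℝ (Fin n)) M]
  {F : Type*} [NormedAddCommGroup F] [NormedSpace ℝ F]
  {V : M → Type*} [TopologicalSpace (Bundle.TotalSpace F V)] [∀ m, AddCommGroup (V m)]
  [∀ m, Module ℝ (V m)] [∀ m, TopologicalSpace (V m)] [FiberBundle F V] [VectorBundle ℝ F V]
  [T2Space M] [SigmaCompactSpace M] [IsManifold (𝓡 n) ∞ M] [FiniteDimensional ℝ F]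
  [ContMDiffVectorBundle ∞ F V (𝓡 n)] {A : ProjLieAlgebroid n F V}

/-- Derivations are compatible with the anchor. -/
theorem Der.anchor (δ : A.Der) (a : A.Sections) : (δ.1.1 a).1.1 = δ.1.2.lie a.1.1 := by
  have hder : ∀ (f : SmoothFn n M) c, δ.1.1 (f • c) = δ.1.2.app f • c + f • δ.1.1 c := δ.2.1
  have hbr : ∀ c d, δ.1.1 (A.bracket c d) = A.bracket (δ.1.1 c) d + A.bracket c (δ.1.1 d) := δ.2.2
  ext m
  -- Where A has rank zero, all its sections vanish near m and both sides are zero at m. Elsewhere a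
  -- nonzero vector of A at m can be cancelled from an identity in Γ(A).
  by_cases hm : A.fiber m = ⊥
  · obtain ⟨k, s, hs⟩ := A.isSubbundle m
    have hk : k = 0 := by
      by_contra hk
      have h1 := hs.self_of_nhds.1.ne_zero ⟨0, Nat.pos_of_ne_zero hk⟩
      have h2 := Submodule.subset_span (R := ℝ)
        (Set.mem_range_self (f := fun i => evT m (s i)) ⟨0, Nat.pos_of_ne_zero hk⟩)
      rw [hs.self_of_nhds.2, hm] at h2
      exact h1 h2
    subst hk
    have hbot : {p | A.fiber p = ⊥} ∈ 𝓝 m := by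
      filter_upwards [hs] with p hp
      rw [← hp.2, Set.range_eq_empty, Submodule.span_empty]
    have hfst : ∀ c : A.Sections, ∀ p, A.fiber p = ⊥ → c.1.1 p = 0 := fun c p hp => by
      have h := c.2 p
      rw [hp] at h
      exact congrArg Prod.fst h
    obtain ⟨χ, h1, h2, -⟩ := exists_bump (n := n) hbot
    have hχ : a.1.1 = (1 - χ) • a.1.1 := by
      ext p
      change a.1.1 p = (1 - χ p) • a.1.1 p
      by_cases hp : A.fiber p = ⊥
      · rw [hfst a p hp, smul_zero]
      · rw [image_eq_zero_of_notMem_tsupport fun h => hp (h2 h), sub_zero, one_smul]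
    rw [hχ, VField.lie_smul, hfst _ m hm]
    change 0 = δ.1.2.app (1 - χ) m • a.1.1 m + (1 - χ m) • δ.1.2.lie a.1.1 m
    rw [hfst a m hm, h1.self_of_nhds, sub_self, smul_zero, zero_smul, add_zero]
  · obtain ⟨ξ, hξ, hξ0⟩ := (Submodule.ne_bot_iff _).1 hm
    obtain ⟨t, ht⟩ := (isSectionModule_tSec (n := n) (F := F) (V := V)).surjective m ξ
    have hc : evT m (A.toSections t).1 = ξ := by
      rw [toSections_coe, A.evT_projector (by rw [ht]; exact hξ), ht]
    rw [← sub_eq_zero]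
    refine tangent_eq_zero fun f => ?_
    -- With c = `A.toSections t`, the two computations of δ[a, f c]_A differ exactly by this
    -- multiple of c.
    have key : ((δ.1.1 a).1.1.app f - (δ.1.2.lie a.1.1).app f) • A.toSections t = 0 := by
      have e := hbr a (f • A.toSections t)
      simp only [A.leibniz, hder, map_add, hbr] at e
      rw [VField.lie_app, ← sub_eq_zero.2 e.symm]
      module
    have h1 : ((δ.1.1 a).1.1.app f m - (δ.1.2.lie a.1.1).app f m) • ξ = 0 := by
      rw [← hc]
      exact congrArg (fun c : A.Sections => evT m c.1) key
    rw [map_sub]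
    exact (smul_eq_zero.1 h1).resolve_right hξ0

/-- Since 𝐛Z = 0, pairing Z with a lift of c leaves only the E-component of Z̲(c), and isotropy
makes it vanish at m. -/
theorem falling_snd_eq_zero_of_ev_mem {m : M} {Z : OmniSec n F V} (hZ : b n F V Z = 0)
    (h : ev m Z ∈ A.liftFiber m) (c : A.Sections) : (falling Z c.1).2 m = 0 := by
  obtain ⟨X, a, hX, hm⟩ := exists_isLift_ev h
  obtain ⟨W, hW⟩ := A.exists_isLift c
  have h3 : (2 : ℝ) • Z.pairing W m = _ :=
    congrArg (fun s : Sec n F V => s m) (two_smul_pairing Z W)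
  have hW0 : (falling W (0 : TSec n F V)).2 = 0 := by
    have := falling_sub_right W (0 : TSec n F V) 0
    rw [sub_self, sub_self] at this
    rw [this]
    rfl
  rw [pairing_congr hm.symm (rfl : ev m W = ev m W), hX.pairing_eq_zero hW, hZ, hW.1, hW0,
    add_zero] at h3
  rw [← h3]
  exact smul_zero _

/-- The lift is a subbundle. -/
theorem isSubbundle_liftFiber : IsSubbundle (Γ := OmniSec n F V) ev A.liftFiber := by
  classical
  intro m₀
  have hT := isSectionModule_tSec (n := n) (F := F) (V := V)
  obtain ⟨k, s, hs⟩ := A.isSubbundle m₀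
  have hs_mem : ∀ m, (Submodule.span ℝ (Set.range fun i => evT m (s i)) = A.fiber m) →
      ∀ i, evT m (A.toSections (s i)).1 = evT m (s i) := fun m hm i => by
    refine A.evT_projector ?_
    rw [← hm]
    exact Submodule.subset_span ⟨i, rfl⟩
  let a : Fin k → A.Sections := fun i => A.toSections (s i)
  have hli : LinearIndependent ℝ fun i => evT m₀ (a i).1 := by
    have := hs.self_of_nhds
    simp_rw [a, hs_mem m₀ this.2]
    exact this.1
  obtain ⟨l, c, g, hg⟩ := hT.exists_extension (fun i => (a i).1) hli
  obtain ⟨Fr⟩ := (isSectionModule_sec (n := n) (F := F) (V := V)).frame m₀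
  choose X hX using fun i => A.exists_isLift (a i)
  -- Elementary tensors: the functionals dual to the complement c of the frame of A, times a frame
  -- of E. At points near m₀ they form a basis of Hom(𝓣/A, E).
  let Y : Fin l × Fr.ι → OmniSec n F V := fun q =>
    ofTensor n F V ((g (Sum.inr q.1)).smulRight (Fr.vec q.2))
  have hYfall : ∀ q t, falling (Y q) t = (0, g (Sum.inr q.1) t • Fr.vec q.2) := fun q t => by
    rw [falling_ofTensor]
    rfl
  let φ : Fin k ⊕ (Fin l × Fr.ι) → OmniSec n F V := Sum.elim X Y
  suffices h : ∀ᶠ m in 𝓝 m₀, LinearIndependent ℝ (fun i => ev m (φ i)) ∧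
      Submodule.span ℝ (Set.range fun i => ev m (φ i)) = A.liftFiber m by
    let ε := Fintype.equivFin (Fin k ⊕ (Fin l × Fr.ι))
    refine ⟨_, φ ∘ ε.symm, ?_⟩
    filter_upwards [h] with m hm
    refine ⟨hm.1.comp _ ε.symm.injective, ?_⟩
    rw [← hm.2]
    congr 1
    exact ε.symm.surjective.range_comp (fun i => ev m (φ i))
  filter_upwards [hs, hg, Fr.nhd_mem] with m hsm hgm hFr
  have hspan : Submodule.span ℝ (Set.range fun i => evT m (a i).1) = A.fiber m := by
    simp_rw [a, hs_mem m hsm.2]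
    exact hsm.2
  have hgA : ∀ j t, evT m t ∈ A.fiber m → g (Sum.inr j) t m = 0 := fun j t ht => by
    rw [← hspan] at ht
    obtain ⟨x, hx⟩ := (Submodule.mem_span_range_iff_exists_fun ℝ).1 ht
    have h1 : evT m t = evT m (∑ i, x i • (a i).1) := by simpa using hx.symm
    rw [hT.functional_eq (g (Sum.inr j)) h1, map_sum, SmoothFn.sum_apply]
    refine Finset.sum_eq_zero fun i _ => ?_
    rw [LinearMap.map_smul_of_tower]
    have := hgm.1 (Sum.inr j) (Sum.inl i)
    simp only [Sum.elim_inl, reduceCtorEq, if_false] at this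
    change x i * _ = 0
    rw [this, mul_zero]
  have hYmem : ∀ q, ev m (Y q) ∈ A.liftFiber m := fun q => by
    have hb : b n F V (Y q) = 0 := b_ofTensor _
    refine ev_mem_liftFiber (by rw [hb]; exact zero_mem _) fun d => ?_
    rw [show ofMem _ = (0 : A.Sections) from sections_ext hb, map_zero, hYfall]
    refine Prod.ext rfl ?_
    change g (Sum.inr q.1) d.1 m • Fr.vec q.2 m = 0
    rw [hgA _ _ (d.2 m), zero_smul]
  have hsum : ∀ (x : Fin l × Fr.ι → ℝ) t, (falling (∑ q, x q • Y q) t).2 m =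
      ∑ j, g (Sum.inr j) t m • ∑ i, x (j, i) • Fr.vec i m := fun x t => by
    let Φ : OmniSec n F V →ₗ[ℝ] V m :=
      { toFun := fun X => (falling X t).2 m
        map_add' := fun X Y => by rw [falling_add_left]; rfl
        map_smul' := fun r X => by rw [falling_rsmul_left]; rfl }
    change Φ _ = _
    rw [map_sum, Fintype.sum_prod_type]
    refine Finset.sum_congr rfl fun j _ => ?_
    rw [Finset.smul_sum]
    refine Finset.sum_congr rfl fun i _ => ?_
    rw [map_smul, smul_comm]
    congr 1
    change (falling (Y (j, i)) t).2 m = _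
    rw [hYfall]
    rfl
  have hbsum : ∀ x : Fin l × Fr.ι → ℝ, b n F V (∑ q, x q • Y q) = 0 := fun x => by
    rw [map_sum]
    refine Finset.sum_eq_zero fun q _ => ?_
    rw [LinearMap.map_smul_of_tower, b_ofTensor, smul_zero]
  refine ⟨Fintype.linearIndependent_iff.2 fun x hx => ?_, le_antisymm ?_ fun ξ hξ => ?_⟩
  · rw [Fintype.sum_sum_type] at hx
    have hx' : ev m (∑ i, x (Sum.inl i) • X i + ∑ q, x (Sum.inr q) • Y q) = 0 := by
      rw [map_add, map_sum, map_sum, ← hx]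
      simp [φ]
    have h1 := evT_b_eq_zero hx'
    rw [map_add, hbsum, add_zero, map_sum, map_sum] at h1
    have hxl : ∀ i, x (Sum.inl i) = 0 := by
      have hli := (hT.linearIndependent_of_dual hgm.1).comp _ Sum.inl_injective
      refine Fintype.linearIndependent_iff.1 hli _ ?_
      rw [← h1]
      refine Finset.sum_congr rfl fun i _ => ?_
      rw [LinearMap.map_smul_of_tower, (hX i).1]
      rfl
    simp only [hxl, zero_smul, Finset.sum_const_zero, zero_add] at hx'
    rintro (i | ⟨j, i⟩)
    · exact hxl i
    · have h2 : (falling (∑ q, x (Sum.inr q) • Y q) (c j)).2 m = 0 :=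
        congrArg Prod.snd (falling_eq_zero (hbsum _) hx' (c j))
      rw [hsum, Finset.sum_eq_single j] at h2
      · have h3 := hgm.1 (Sum.inr j) (Sum.inr j)
        rw [if_pos rfl] at h3
        change g (Sum.inr j) (c j) m = 1 at h3
        rw [h3, one_smul] at h2
        exact Fintype.linearIndependent_iff.1 (Fr.linearIndependent m hFr) _ h2 i
      · intro j' _ hj'
        have h3 := hgm.1 (Sum.inr j') (Sum.inr j)
        rw [if_neg (by simpa using hj')] at h3
        change g (Sum.inr j') (c j) m = 0 at h3
        rw [h3, zero_smul]
      · simp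
  · rw [Submodule.span_le]
    rintro _ ⟨i | q, rfl⟩
    · exact (hX i).ev_mem m
    · exact hYmem q
  · obtain ⟨X', a', hX', rfl⟩ := exists_isLift_ev hξ
    -- The combination of the `X i` with the projection of X' at m is removed, so that 𝐛Z vanishes
    -- at m.
    let Z := X' - ∑ i, g (Sum.inl i) a'.1 m • X i
    have hZmem : ev m Z ∈ A.liftFiber m := by
      rw [map_sub, map_sum]
      refine sub_mem (hX'.ev_mem m) (sum_mem fun i _ => ?_)
      rw [map_smul]
      exact Submodule.smul_mem _ _ ((hX i).ev_mem m)
    have hbZ : evT m (b n F V Z) = 0 := by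
      have h1 := hgm.2 a'.1
      rw [Fintype.sum_sum_type] at h1
      have h2 : ∑ j, g (Sum.inr j) a'.1 m • evT m (Sum.elim (fun i => (a i).1) c (Sum.inr j)) = 0 :=
        Finset.sum_eq_zero fun j _ => by rw [hgA _ _ (a'.2 m), zero_smul]
      rw [h2, add_zero] at h1
      rw [map_sub, map_sub, hX'.1, h1, map_sum, map_sum, sub_eq_zero]
      refine Finset.sum_congr rfl fun i _ => ?_
      rw [LinearMap.map_smul_of_tower, (hX i).1, map_smul]
      rfl
    let Z' := Z - split n F V (b n F V Z)
    have hZ'b : b n F V Z' = 0 := by rw [map_sub, b_split, sub_self]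
    have hZ' : ev m Z' = ev m Z := by rw [map_sub, ev_split hbZ, sub_zero]
    have hTA := falling_snd_eq_zero_of_ev_mem hZ'b (by rw [hZ']; exact hZmem)
    let T := tensorOf Z' hZ'b
    -- The tensor T kills A at m, so it is determined there by its values on the complementary
    -- vectors c.
    let x : Fin l × Fr.ι → ℝ := fun q => Fr.coeff q.2 (T (c q.1)) m
    have hfin : ev m Z' = ev m (∑ q, x q • Y q) := by
      rw [← sub_eq_zero, ← map_sub]
      refine ev_eq_zero_of_b_eq_zero (by rw [map_sub, hZ'b, hbsum, sub_zero]) fun t => ?_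
      have hsymb : ∀ W : OmniSec n F V, b n F V W = 0 → (falling W t).1 m = 0 := fun W hW => by
        have : W.1.symbol = 0 := congrArg Prod.fst hW
        rw [falling_fst, this, VField.zero_lie]
        rfl
      rw [falling_sub_left, map_sub, sub_eq_zero]
      refine Prod.ext ((hsymb _ hZ'b).trans (hsymb _ (hbsum x)).symm) ?_
      change T t m = (falling (∑ q, x q • Y q) t).2 m
      rw [hsum]
      have h1 : evT m t = evT m (∑ i, g i t m • Sum.elim (fun i => (a i).1) c i) := by
        rw [hgm.2 t, map_sum]
        simp
      have h2 : T t m = T (∑ i, g i t m • Sum.elim (fun i => (a i).1) c i) m :=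
        hT.map_eq (e' := fun m : M => (evSec m : Sec n F V →ₗ[ℝ] V m)) (fun _ _ _ => rfl) T h1
      have h3 : T (∑ i, g i t m • Sum.elim (fun i => (a i).1) c i) m =
          ∑ i, g i t m • T (Sum.elim (fun i => (a i).1) c i) m := by
        have := map_sum ((evSec m : Sec n F V →ₗ[ℝ] V m) ∘ₗ T.restrictScalars ℝ)
          (fun i => g i t m • Sum.elim (fun i => (a i).1) c i) Finset.univ
        refine Eq.trans this (Finset.sum_congr rfl fun i _ => ?_)
        rw [map_smul]
        rfl
      rw [h2, h3, Fintype.sum_sum_type, Finset.sum_eq_zero fun i _ => ?_, zero_add]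
      · refine Finset.sum_congr rfl fun j _ => ?_
        congr 1
        exact Fr.expand m hFr (T (c j))
      · have : T (a i).1 m = 0 := hTA (a i)
        change _ • T (a i).1 m = 0
        rw [this, smul_zero]
    have hX'e : ev m X' = ∑ i, g (Sum.inl i) a'.1 m • ev m (X i) + ∑ q, x q • ev m (Y q) := by
      have h1 : ev m Z = ev m X' - ∑ i, g (Sum.inl i) a'.1 m • ev m (X i) := by
        rw [map_sub, map_sum]
        simp only [map_smul]
      rw [hZ', h1, map_sum] at hfin
      simp only [map_smul] at hfin
      rw [← hfin]
      abel
    rw [hX'e]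
    exact add_mem
      (sum_mem fun i _ => Submodule.smul_mem _ _ (Submodule.subset_span ⟨Sum.inl i, rfl⟩))
      (sum_mem fun q _ => Submodule.smul_mem _ _ (Submodule.subset_span ⟨Sum.inr q, rfl⟩))

variable (A) in
/-- The Dirac structure `L^A`. -/
def lift [Nontrivial F] : DiracStructure n F V where
  fiber := A.liftFiber
  isSubbundle := isSubbundle_liftFiber
  eq_orthogonal := ev_mem_liftFiber_iff
  dorfman_mem X hX Y hY := by
    obtain ⟨a, ha⟩ := exists_isLift_iff.1 hX
    obtain ⟨c, hc⟩ := exists_isLift_iff.1 hY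
    exact exists_isLift_iff.2 ⟨_, ha.dorfman hc⟩

end ProjLieAlgebroid

/-! ## Normalizer and cohomology -/

section Cohomology

variable {n : ℕ} {M : Type*} [TopologicalSpace M] [ChartedSpace (EuclideanSpace ℝ (Fin n)) M]
  {F : Type*} [NormedAddCommGroup F] [NormedSpace ℝ F]
  {V : M → Type*} [TopologicalSpace (Bundle.TotalSpace F V)] [∀ m, AddCommGroup (V m)]
  [∀ m, Module ℝ (V m)] [∀ m, TopologicalSpace (V m)] [FiberBundle F V] [VectorBundle ℝ F V]
  [T2Space M] [SigmaCompactSpace M] [IsManifold (𝓡 n) ∞ M] [FiniteDimensional ℝ F]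
  [ContMDiffVectorBundle ∞ F V (𝓡 n)]

open OmniSec ProjLieAlgebroid

/-- Invariance under l₁ removes ρ(l₁)(X, l₂), leaving ({l₁, X}, l₂) and ρ(l₂)(X, l₁); exchanging l₁
and X produces a jet whose pairing with l₂ cancels the latter. -/
theorem DiracStructure.d1_omega (L : DiracStructure n F V) (X : OmniSec n F V)
    (l₁ l₂ : L.Sections) :
    L.d1 (L.omega X) l₁ l₂ = - OmniSec.pairing (dorfman X l₁.1) l₂.1 := by
  change l₁.1.1.op (X.pairing l₂.1) - l₂.1.1.op (X.pairing l₁.1) -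
    X.pairing (dorfman l₁.1 l₂.1) = _
  have h : OmniSec.pairing (dorfman l₁.1 X) l₂.1 =
      l₂.1.1.op (X.pairing l₁.1) - OmniSec.pairing (dorfman X l₁.1) l₂.1 := by
    rw [dorfman_swap, pairing_comm, pairing_sub_right, pairing_comm l₂.1 (dorfman _ _), two_smul,
      pairing_add_right, pairing_comm, pairing_jetSec]
    module
  rw [op_pairing, h]
  abel

theorem DiracStructure.omega_add (L : DiracStructure n F V) (X Y : OmniSec n F V) :
    L.omega (X + Y) = L.omega X + L.omega Y := by
  refine LinearMap.ext fun l => ?_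
  change (X + Y).pairing l.1 = X.pairing l.1 + Y.pairing l.1
  rw [pairing_comm, pairing_add_right, pairing_comm X, pairing_comm Y]

theorem DiracStructure.omega_sub (L : DiracStructure n F V) (X Y : OmniSec n F V) :
    L.omega (X - Y) = L.omega X - L.omega Y := by
  rw [eq_sub_iff_add_eq, ← L.omega_add, sub_add_cancel]

/-- Coboundaries come from the sections of 𝓔 that fall to zero; the 2 compensates the ½ in the form.
-/
theorem DiracStructure.omega_jetSec (L : DiracStructure n F V) (u : Sec n F V) :
    L.omega (jetSec ((2 : ℝ) • u)) = L.d0 u := by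
  refine LinearMap.ext fun l => ?_
  change OmniSec.pairing (jetSec ((2 : ℝ) • u)) l.1 = l.1.1.op u
  rw [pairing_jetSec, map_smul, smul_smul]
  norm_num

theorem DiracStructure.omega_rsmul (L : DiracStructure n F V) (r : ℝ) (X : OmniSec n F V) :
    L.omega (r • X) = r • L.omega X := by
  refine LinearMap.ext fun l => ?_
  change (1 / 2 : ℝ) • (l.1.2.pair (r • X.1) + r • X.2.pair l.1.1) =
    r • (1 / 2 : ℝ) • (l.1.2.pair X.1 + X.2.pair l.1.1)
  rw [show l.1.2.pair (r • X.1) = r • l.1.2.pair X.1 from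
    LinearMap.map_smul_of_tower l.1.2.1 r X.1]
  module

/-! ### Cocycles and coboundaries for L = L^A. -/

variable [Nontrivial F] (A : ProjLieAlgebroid n F V)

/-- `Γ(L^A)` is its own orthogonal. -/
theorem exists_isLift_iff_pairing {X : OmniSec n F V} :
    (∃ a, A.IsLift X a) ↔ ∀ Y c, A.IsLift Y c → X.pairing Y = 0 := by
  refine ⟨fun ⟨a, ha⟩ Y c hY => ha.pairing_eq_zero hY, fun h => ?_⟩
  rw [← exists_isLift_iff]
  refine fun m => (ev_mem_liftFiber_iff m X).2 fun Y hY => ?_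
  obtain ⟨Y', c, hY', hm⟩ := exists_isLift_ev hY
  rw [pairing_congr_right hm.symm, h Y' c hY']
  rfl

theorem mem_normalizer_lift {X : OmniSec n F V} :
    X ∈ A.lift.normalizer ↔ ∀ Y c, A.IsLift Y c → ∃ d, A.IsLift (dorfman X Y) d :=
  ⟨fun h Y c hY => exists_isLift_iff.1 (h Y (exists_isLift_iff.2 ⟨c, hY⟩)), fun h Y hY => by
    obtain ⟨c, hc⟩ := exists_isLift_iff.1 hY
    exact exists_isLift_iff.2 (h Y c hc)⟩

/-- `N_L` consists of the sections whose cochain is closed. -/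
theorem mem_normalizer_lift_iff {X : OmniSec n F V} :
    X ∈ A.lift.normalizer ↔ A.lift.d1 (A.lift.omega X) = 0 := by
  rw [mem_normalizer_lift]
  constructor
  · intro h
    funext l₁ l₂
    obtain ⟨a, ha⟩ := exists_isLift_iff.1 l₁.2
    obtain ⟨c, hc⟩ := exists_isLift_iff.1 l₂.2
    obtain ⟨d, hd⟩ := h _ _ ha
    rw [DiracStructure.d1_omega, hd.pairing_eq_zero hc, neg_zero]
    rfl
  · intro h Y c hY
    refine (exists_isLift_iff_pairing A).2 fun Z d hZ => ?_
    have h1 := DiracStructure.d1_omega A.lift X ⟨Y, exists_isLift_iff.2 ⟨c, hY⟩⟩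
      ⟨Z, exists_isLift_iff.2 ⟨d, hZ⟩⟩
    rw [h] at h1
    exact neg_eq_zero.1 h1.symm

/-- Sections of `𝓔` normalizing the lift and falling to a given derivation. -/
theorem exists_fallsTo (δ : A.Der) : ∃ X ∈ A.lift.normalizer, A.FallsTo X δ := by
  -- The symbol must be that of δ; the E-component can be shifted by a jet, which falls to zero, so
  -- 0 will do.
  obtain ⟨X, hX, hδ⟩ := A.exists_falling (δ.1.2, 0) δ.1.1 δ.2.1 δ.anchor
  have hs : X.1.symbol = δ.1.2 := congrArg Prod.fst hX
  refine ⟨X, (mem_normalizer_lift A).2 fun Y c hY => ⟨δ.1.1 c, ?_, fun d => ?_⟩, hδ, hs⟩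
  · rw [← falling_b, hY.1, hδ]
  · rw [falling_dorfman, hY.2, hδ, hδ, hY.2]
    have h : δ.1.1 (A.bracket c d) = A.bracket (δ.1.1 c) d + A.bracket c (δ.1.1 d) := δ.2.2 c d
    rw [h]
    exact add_sub_cancel_right (A.bracket (δ.1.1 c) d).1 _

/-- As L is its own orthogonal, ω_X is exact precisely when X differs from a section of L by a jet,
and jets do not affect the falling. -/
theorem omega_mem_B1_iff {X : OmniSec n F V} :
    A.lift.omega X ∈ A.lift.B1 ↔ ∃ a, A.FallsTo X (A.ad a) := by
  constructor
  · rintro ⟨u, hu⟩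
    rw [← DiracStructure.omega_jetSec] at hu
    obtain ⟨a, ha⟩ := (exists_isLift_iff_pairing A (X := X - jetSec ((2 : ℝ) • u))).2
      fun Y c hY => by
        have h1 : A.lift.omega (X - jetSec ((2 : ℝ) • u)) = 0 := by
          rw [DiracStructure.omega_sub, hu, sub_self]
        exact LinearMap.congr_fun h1 ⟨Y, exists_isLift_iff.2 ⟨c, hY⟩⟩
    refine ⟨a, fun c => ?_, ?_⟩
    · have := ha.2 c
      rwa [falling_sub_left, falling_jetSec, sub_zero] at this
    · have h1 : X.1.symbol - (0 : VField n M) = a.1.1 := congrArg Prod.fst ha.1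
      rw [sub_zero] at h1
      exact h1
  · rintro ⟨a, ha, hs⟩
    obtain ⟨Y, hY⟩ := A.exists_isLift a
    -- X - Y has zero symbol, as `FallsTo` also compares symbols. Subtracting 𝕕w removes its
    -- E-component and keeps its falling, which vanishes on A.
    let w : Sec n F V := (X - Y).2.proj
    have hb : b n F V (X - Y - jetSec w) = 0 := by
      refine Prod.ext ?_ ?_
      · have h1 : Y.1.symbol = a.1.1 := congrArg Prod.fst hY.1
        change X.1.symbol - Y.1.symbol - (0 : VField n M) = 0
        rw [hs, h1, sub_zero]
        exact sub_self a.1.1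
      · change w - (JetSec.jet w).proj = 0
        exact sub_self w
    have hl : A.IsLift (X - Y - jetSec w) 0 := by
      refine ⟨hb, fun c => ?_⟩
      rw [falling_sub_left, falling_sub_left, falling_jetSec, hY.2, ha, map_zero, sub_zero]
      exact sub_self (A.bracket a c).1
    have h0 : A.lift.omega (X - Y - jetSec w + Y) = 0 := by
      refine LinearMap.ext fun l => ?_
      obtain ⟨c, hc⟩ := exists_isLift_iff.1 l.2
      exact (hl.add hY).pairing_eq_zero hc
    refine ⟨(1 / 2 : ℝ) • w, ?_⟩
    rw [← DiracStructure.omega_jetSec, smul_smul]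
    norm_num
    rw [← sub_eq_zero, ← neg_eq_zero, neg_sub, ← DiracStructure.omega_sub, ← h0]
    congr 1
    abel

/-! ### The map from Ext(A) to H¹. -/

variable {A}

theorem ProjLieAlgebroid.FallsTo.add {X Y : OmniSec n F V} {δ ε : A.Der} (hX : A.FallsTo X δ)
    (hY : A.FallsTo Y ε) : A.FallsTo (X + Y) (δ + ε) :=
  ⟨fun a => by rw [falling_add_left, hX.1, hY.1]; rfl, congrArg₂ (· + ·) hX.2 hY.2⟩

theorem ProjLieAlgebroid.FallsTo.sub {X Y : OmniSec n F V} {δ ε : A.Der} (hX : A.FallsTo X δ)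
    (hY : A.FallsTo Y ε) : A.FallsTo (X - Y) (δ - ε) :=
  ⟨fun a => by rw [falling_sub_left, hX.1, hY.1]; rfl, congrArg₂ (· - ·) hX.2 hY.2⟩

theorem ProjLieAlgebroid.FallsTo.rsmul {X : OmniSec n F V} {δ : A.Der} (hX : A.FallsTo X δ) (r : ℝ) :
    A.FallsTo (r • X) (r • δ) :=
  ⟨fun a => by rw [falling_rsmul_left, hX.1]; rfl, congrArg (r • ·) hX.2⟩

theorem ProjLieAlgebroid.FallsTo.unique {X : OmniSec n F V} {δ ε : A.Der} (hX : A.FallsTo X δ)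
    (hX' : A.FallsTo X ε) : δ = ε :=
  Subtype.ext (Prod.ext (LinearMap.ext fun a => sections_ext ((hX.1 a).symm.trans (hX'.1 a)))
    (hX.2.symm.trans hX'.2))

variable (A)

/-- The cocycle `ω_X` of a section in the normalizer. -/
def cocycle {X : OmniSec n F V} (hX : X ∈ A.lift.normalizer) : A.lift.Z1 :=
  ⟨A.lift.omega X, (mem_normalizer_lift_iff A).1 hX⟩

/-- This is the exactness criterion for X - Y. With δ = ε it gives independence of the choice of
X_δ, with ε = 0 the kernel. -/
theorem toH1_cocycle_eq_iff {X Y : OmniSec n F V} (hX : X ∈ A.lift.normalizer)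
    (hY : Y ∈ A.lift.normalizer) {δ ε : A.Der} (hδ : A.FallsTo X δ) (hε : A.FallsTo Y ε) :
    A.lift.toH1 (cocycle A hX) = A.lift.toH1 (cocycle A hY) ↔ δ - ε ∈ A.inn := by
  have h1 : A.lift.toH1 (cocycle A hX) = A.lift.toH1 (cocycle A hY) ↔
      A.lift.omega X - A.lift.omega Y ∈ A.lift.B1 :=
    (Submodule.Quotient.eq _).trans Iff.rfl
  rw [h1, ← DiracStructure.omega_sub, omega_mem_B1_iff]
  constructor
  · rintro ⟨a, ha⟩
    exact ⟨a, FallsTo.unique ha (FallsTo.sub hδ hε)⟩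
  · rintro ⟨a, ha⟩
    exact ⟨a, by rw [ha]; exact FallsTo.sub hδ hε⟩

/-- The class of `ω_{X_δ}`, as a linear function of the derivation `δ`. -/
def derToH1 : A.Der →ₗ[ℝ] A.lift.H1 where
  toFun δ := A.lift.toH1 (cocycle A (exists_fallsTo A δ).choose_spec.1)
  map_add' δ ε := by
    have hδ := (exists_fallsTo A δ).choose_spec
    have hε := (exists_fallsTo A ε).choose_spec
    have hs := (exists_fallsTo A (δ + ε)).choose_spec
    rw [← map_add]
    have hn : (exists_fallsTo A δ).choose + (exists_fallsTo A ε).choose ∈ A.lift.normalizer := by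
      rw [mem_normalizer_lift_iff, DiracStructure.omega_add, map_add,
        (mem_normalizer_lift_iff A).1 hδ.1, (mem_normalizer_lift_iff A).1 hε.1, add_zero]
    have e : cocycle A hδ.1 + cocycle A hε.1 = cocycle A hn :=
      Subtype.ext (DiracStructure.omega_add _ _ _).symm
    rw [e, toH1_cocycle_eq_iff A hs.1 hn hs.2 (FallsTo.add hδ.2 hε.2), sub_self]
    exact zero_mem _
  map_smul' r δ := by
    have hδ := (exists_fallsTo A δ).choose_spec
    have hs := (exists_fallsTo A (r • δ)).choose_spec
    rw [RingHom.id_apply, ← map_smul]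
    have hn : r • (exists_fallsTo A δ).choose ∈ A.lift.normalizer := by
      rw [mem_normalizer_lift_iff, DiracStructure.omega_rsmul, map_smul,
        (mem_normalizer_lift_iff A).1 hδ.1, smul_zero]
    have e : r • cocycle A hδ.1 = cocycle A hn :=
      Subtype.ext (DiracStructure.omega_rsmul _ _ _).symm
    rw [e, toH1_cocycle_eq_iff A hs.1 hn hs.2 (FallsTo.rsmul hδ.2 r), sub_self]
    exact zero_mem _

theorem derToH1_eq {X : OmniSec n F V} (hX : X ∈ A.lift.normalizer) {δ : A.Der}
    (hδ : A.FallsTo X δ) : derToH1 A δ = A.lift.toH1 (cocycle A hX) := by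
  have hs := (exists_fallsTo A δ).choose_spec
  refine (toH1_cocycle_eq_iff A hs.1 hX hs.2 hδ).2 ?_
  rw [sub_self]
  exact zero_mem _

theorem ker_derToH1 : LinearMap.ker (derToH1 A) = A.inn := by
  ext δ
  have hs := (exists_fallsTo A δ).choose_spec
  obtain ⟨Y, hY, hY0⟩ := exists_fallsTo A 0
  have h := toH1_cocycle_eq_iff A hs.1 hY hs.2 hY0
  rw [← derToH1_eq A hY hY0, map_zero, sub_zero] at h
  exact h

end Cohomology

end OmniLie

end

theorem corollary6p3 {n : ℕ} {M : Type*} [TopologicalSpace M]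
    [ChartedSpace (EuclideanSpace ℝ (Fin n)) M] [IsManifold (𝓡 n) ∞ M]
    [T2Space M] [SecondCountableTopology M]
    {F : Type*} [NormedAddCommGroup F] [NormedSpace ℝ F] [FiniteDimensional ℝ F] [Nontrivial F]
    {V : M → Type*} [TopologicalSpace (Bundle.TotalSpace F V)] [∀ m, AddCommGroup (V m)]
    [∀ m, Module ℝ (V m)] [∀ m, TopologicalSpace (V m)] [FiberBundle F V] [VectorBundle ℝ F V]
    [ContMDiffVectorBundle ∞ F V (𝓡 n)]
    (A : OmniLie.ProjLieAlgebroid n F V) :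
    -- the lift `L^A` is a Dirac structure `L`
    ∃ L : OmniLie.DiracStructure n F V, (∀ m, L.fiber m = A.liftFiber m) ∧
      -- `X ∈ N_L` if and only if `d_L ω_X = 0`
      (∀ X, X ∈ L.normalizer ↔ L.d1 (L.omega X) = 0) ∧
      -- for `X ∈ N_L`, `ω_X` is exact if and only if the falling of `X` on `A` is inner
      (∀ X ∈ L.normalizer, L.omega X ∈ L.B1 ↔ ∃ a, A.FallsTo X (A.ad a)) ∧
      -- every derivation `δ` of `A` is the falling of some `X_δ ∈ N_L`
      (∀ δ : A.Der, ∃ X ∈ L.normalizer, A.FallsTo X δ) ∧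
      -- `δ ↦ ω_{X_δ}` induces an injective linear map, whatever the choice of `X_δ`
      ∃ i : A.Ext →ₗ[ℝ] L.H1, Function.Injective i ∧
        ∀ (δ : A.Der), ∀ X ∈ L.normalizer, A.FallsTo X δ →
          ∃ h : L.omega X ∈ L.Z1, i (Submodule.Quotient.mk δ) = L.toH1 ⟨L.omega X, h⟩ := by
  have : LocallyCompactSpace M := ChartedSpace.locallyCompactSpace (EuclideanSpace ℝ (Fin n)) M
  have : SigmaCompactSpace M := inferInstance
  refine ⟨A.lift, fun _ => rfl, fun X => OmniLie.mem_normalizer_lift_iff A,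
    fun X _ => OmniLie.omega_mem_B1_iff A, OmniLie.exists_fallsTo A,
    A.inn.liftQ (OmniLie.derToH1 A) (OmniLie.ker_derToH1 A).ge, ?_, fun δ X hX hδ =>
      ⟨(OmniLie.mem_normalizer_lift_iff A).1 hX, OmniLie.derToH1_eq A hX hδ⟩⟩
  rw [← LinearMap.ker_eq_bot]
  exact Submodule.ker_liftQ_eq_bot _ _ _ (OmniLie.ker_derToH1 A).le
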